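/- Let $\Lambda\subset\mathbb{R}^n\times\mathbb{R}^m$ and let $\{M_k\}_{k\ge 0}$ be a sequence of real numbers such that $M_0=1$ and $M_k\ge k!$ for all $k\ge 0$; $M_k^{1/k}$ is strictly increasing in $k\ge 1$; and there is a constant $C>0$ with $M_{k+1}\le C^kM_k$ for all $k\ge 0$. Notation. The Carleman class $C\{M_k\}$ (resp. the Beurling class $C(M_k)$) is the set of all $g\in C^\infty(\mathbb{R}^n)$ such that for every compact $K\subset\mathbb{R}^n$, $$\sup_{\alpha\in\mathbb{Z}_+^n}\ \sup_{x\in K}\ \frac{|\partial^\alpha g(x)|}{h^{|\alpha|}M_{|\alpha|}}<\infty$$ for some $h>0$ (resp. for every $h>0$); a map into $\mathbb{R}^m$ belongs to one of these classes if each of its components does. For $\xi\in\mathbb{R}^n$ put $D_\xi^jg(x)=\frac{d^j}{dt^j}g(x+t\xi)\big|_{t=0}$, and let $C^\infty_\xi$ be the set of continuous $g:\mathbb{R}^n\to\mathbb{R}$ for which all $D_\xi^jg$, $j\ge 1$, exist everywhere and are continuous on $\mathbb{R}^n$. The directional class $C\{M_k\}(\xi)$ (resp. $C(M_k)(\xi)$)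 is the set of all $g\in C^\infty_\xi$ such that for every compact $K\subset\mathbb{R}^n$, $\sup_{j\ge 0}\sup_{x\in K}|D_\xi^jg(x)|\,h^{-j}M_j^{-1}<\infty$ for some $h>0$ (resp. for every $h>0$). Then the following statements are equivalent: (i) $\Lambda$ is a determining set for bilinear forms of rank 1, i.e. no bilinear form of rank 1 on $\mathbb{R}^n\times\mathbb{R}^m$ vanishes at all points of $\Lambda$ (equivalently: if $u\in\mathbb{R}^n$, $v\in\mathbb{R}^m$ and $\langle u,\xi\rangle\langle v,\eta\rangle=0$ for all $(\xi,\eta)\in\Lambda$, then $u=0$ or $v=0$); (ii) every locally bounded map $f:\mathbb{R}^n\to\mathbb{R}^m$ with $\langle\eta,f\rangle\in C\{M_k\}(\xi)$ for all $(\xi,\eta)\in\Lambda$ belongs to $C\{M_k\}$; (iii) every locally bounded map $f:\mathbb{R}^n\to\mathbb{R}^m$ with $\langle\eta,f\rangle\in C(M_k)(\xi)$ for all $(\xi,\eta)\in\Lambda$ belongs to $C(M_k)$; (iv) every locally bounded map $f:\mathbb{R}^n\to\mathbb{R}^m$ with $\langle\eta,f\rangle\in C^\infty_\xi$ for all $(\xi,\eta)\in\Lambda$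 is of class $C^\infty$. -/

import Mathlib

open scoped ContDiff Topology

namespace Boman

/-- A map is locally bounded if every point has a neighbourhood on which it is bounded. -/
def LocallyBounded {n m : ℕ} (f : EuclideanSpace ℝ (Fin n) → EuclideanSpace ℝ (Fin m)) : Prop :=
  ∀ x, ∃ U ∈ 𝓝 x, Bornology.IsBounded (f '' U)

/-- The partial derivative `∂g/∂x_i`. -/
noncomputable def partialDeriv {n : ℕ} (i : Fin n) (g : EuclideanSpace ℝ (Fin n) → ℝ) :
    EuclideanSpace ℝ (Fin n) → ℝ :=
  fun x => lineDeriv ℝ g x (EuclideanSpace.single i 1)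

/-- The partial derivative `∂^α g = ∂₁^{α₁} ⋯ ∂ₙ^{αₙ} g` for a multi-index `α`. -/
noncomputable def multiDeriv {n : ℕ} (α : Fin n → ℕ) (g : EuclideanSpace ℝ (Fin n) → ℝ) :
    EuclideanSpace ℝ (Fin n) → ℝ :=
  (List.finRange n).foldr (fun i φ => (partialDeriv i)^[α i] φ) g

/-- `p_{h,K}(g) < ∞`, where `p_{h,K}(g)` is the supremum over all multi-indices `α` and all
`x ∈ K` of `|∂^α g(x)| / (h^{|α|} M_{|α|})`. -/
def SeminormFinite {n : ℕ} (M : ℕ → ℝ) (h : ℝ) (K : Set (EuclideanSpace ℝ (Fin n)))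
    (g : EuclideanSpace ℝ (Fin n) → ℝ) : Prop :=
  ∃ A : ℝ, ∀ α : Fin n → ℕ, ∀ x ∈ K,
    |multiDeriv α g x| / (h ^ (∑ i, α i) * M (∑ i, α i)) ≤ A

/-- The Carleman class `C{M_k}` of real functions on `ℝⁿ`. -/
def Carleman {n : ℕ} (M : ℕ → ℝ) (g : EuclideanSpace ℝ (Fin n) → ℝ) : Prop :=
  ContDiff ℝ ∞ g ∧
    ∀ K : Set (EuclideanSpace ℝ (Fin n)), IsCompact K → ∃ h : ℝ, 0 < h ∧ SeminormFinite M h K g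

/-- The Beurling class `C(M_k)` of real functions on `ℝⁿ`. -/
def Beurling {n : ℕ} (M : ℕ → ℝ) (g : EuclideanSpace ℝ (Fin n) → ℝ) : Prop :=
  ContDiff ℝ ∞ g ∧
    ∀ K : Set (EuclideanSpace ℝ (Fin n)), IsCompact K → ∀ h : ℝ, 0 < h → SeminormFinite M h K g

/-- The directional derivative `D_ξ^j g(x) = (d/dt)^j g(x + tξ)` at `t = 0`. -/
noncomputable def dirDeriv {n : ℕ} (ξ : EuclideanSpace ℝ (Fin n)) (j : ℕ)
    (g : EuclideanSpace ℝ (Fin n) → ℝ) : EuclideanSpace ℝ (Fin n) → ℝ :=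
  fun x => iteratedDeriv j (fun t : ℝ => g (x + t • ξ)) 0

/-- The class `C_ξ^∞`: continuous functions all of whose derivatives `D_ξ^j g`, `j ≥ 1`, exist
everywhere and are continuous on `ℝⁿ`. -/
def DirSmooth {n : ℕ} (ξ : EuclideanSpace ℝ (Fin n)) (g : EuclideanSpace ℝ (Fin n) → ℝ) : Prop :=
  Continuous g ∧ (∀ x, ContDiff ℝ ∞ (fun t : ℝ => g (x + t • ξ))) ∧
    ∀ j : ℕ, 1 ≤ j → Continuous (dirDeriv ξ j g)

/-- Finiteness of the supremum over all `j ≥ 0` and `x ∈ K` of `|D_ξ^j g(x)| / (h^j M_j)`. -/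
def DirSeminormFinite {n : ℕ} (M : ℕ → ℝ) (ξ : EuclideanSpace ℝ (Fin n)) (h : ℝ)
    (K : Set (EuclideanSpace ℝ (Fin n))) (g : EuclideanSpace ℝ (Fin n) → ℝ) : Prop :=
  ∃ A : ℝ, ∀ j : ℕ, ∀ x ∈ K, |dirDeriv ξ j g x| / (h ^ j * M j) ≤ A

/-- The directional Carleman class `C{M_k}(ξ)`. -/
def DirCarleman {n : ℕ} (M : ℕ → ℝ) (ξ : EuclideanSpace ℝ (Fin n))
    (g : EuclideanSpace ℝ (Fin n) → ℝ) : Prop :=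
  DirSmooth ξ g ∧ ∀ K : Set (EuclideanSpace ℝ (Fin n)), IsCompact K →
    ∃ h : ℝ, 0 < h ∧ DirSeminormFinite M ξ h K g

/-- The directional Beurling class `C(M_k)(ξ)`. -/
def DirBeurling {n : ℕ} (M : ℕ → ℝ) (ξ : EuclideanSpace ℝ (Fin n))
    (g : EuclideanSpace ℝ (Fin n) → ℝ) : Prop :=
  DirSmooth ξ g ∧ ∀ K : Set (EuclideanSpace ℝ (Fin n)), IsCompact K →
    ∀ h : ℝ, 0 < h → DirSeminormFinite M ξ h K g

/-- `Λ ⊆ ℝⁿ × ℝᵐ` is a determining set for bilinear forms of rank 1: no bilinear form of rank 1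
vanishes on `Λ`. The rank of a bilinear form is the rank of the associated linear map from `ℝⁿ`
to the dual of `ℝᵐ`. -/
def IsDetermining {n m : ℕ} (Λ : Set (EuclideanSpace ℝ (Fin n) × EuclideanSpace ℝ (Fin m))) :
    Prop :=
  ¬ ∃ φ : EuclideanSpace ℝ (Fin n) →ₗ[ℝ] EuclideanSpace ℝ (Fin m) →ₗ[ℝ] ℝ,
    Module.finrank ℝ (LinearMap.range φ) = 1 ∧ ∀ p ∈ Λ, φ p.1 p.2 = 0

end Boman

/-! A determining set is an ellipticity condition: for every ζ ≠ 0, the η with (ξ, η) ∈ Λ and ⟨ξ, ζ⟩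
≠ 0 span ℝᵐ, since a nonzero v orthogonal to them all would give the forbidden form ⟨ζ, ·⟩⟨v, ·⟩.
One may pass to a finite T ⊆ Λ (`IsDetermining.exists_finset`), and then spanning becomes uniform in
ζ (`IsDetermining.exists_coeff`): each basis vector is a combination, with bounded coefficients, of
those η for which |⟨ξ, ζ⟩| ≥ c‖ζ‖.

Hence the Fourier transform of χ fᵢ at ζ is a bounded combination of transforms of χ⟨η, f⟩, and k
derivatives along ξ make each of these O(‖ζ‖⁻ᵏ). Fourier inversion then turns order l + n + 1 of
directional regularity into order l of full regularity.

The classes may be quasianalytic, so no single cutoff will do. Instead χ depends on k, with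
derivatives of order j ≤ k at most (C‖ξ‖k/R)ʲ (`exists_cutoff`). The inequality M_{k-j} kʲ ≤ eʲ M_k
(`weight_mul_pow_le`) absorbs these powers of k in the Leibniz formula, and M_{k+1} ≤ Cᵏ M_k absorbs
the n + 1 lost derivatives. The resulting parameter is B(1/R + h) with B independent of R and h;
letting R grow settles the Beurling case.

Conversely, if ⟨u, ξ⟩⟨v, η⟩ = 0 on Λ with u, v ≠ 0, then f(x) = |⟨u, x⟩| v is not smooth, although
each ⟨η, f⟩ is constant along ξ. -/

namespace Boman

open MeasureTheory Metric Filter Set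

/-! ### Calculus of derivatives along a fixed direction -/

section Directional

variable {n : ℕ} {ξ : EuclideanSpace ℝ (Fin n)} {g χ : EuclideanSpace ℝ (Fin n) → ℝ}

theorem iteratedDeriv_line (ξ : EuclideanSpace ℝ (Fin n)) (j : ℕ)
    (g : EuclideanSpace ℝ (Fin n) → ℝ) (x : EuclideanSpace ℝ (Fin n)) (s : ℝ) :
    iteratedDeriv j (fun t : ℝ => g (x + t • ξ)) s = dirDeriv ξ j g (x + s • ξ) := by
  have h := congrFun (iteratedDeriv_comp_const_add j (fun t : ℝ => g (x + t • ξ)) s) 0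
  simp only [add_zero] at h
  rw [← h, dirDeriv]
  congr 1
  ext t
  rw [add_smul, add_assoc]

@[simp]
theorem dirDeriv_zero : dirDeriv ξ 0 g = g := by
  ext x; simp [dirDeriv]

theorem dirDeriv_succ (j : ℕ) (x : EuclideanSpace ℝ (Fin n)) :
    dirDeriv ξ (j + 1) g x = lineDeriv ℝ (dirDeriv ξ j g) x ξ := by
  rw [dirDeriv, iteratedDeriv_succ, lineDeriv]
  congr 1
  ext t
  exact iteratedDeriv_line ξ j g x t

theorem DirSmooth.hasLineDerivAt (hg : DirSmooth ξ g) (j : ℕ) (x : EuclideanSpace ℝ (Fin n)) :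
    HasLineDerivAt ℝ (dirDeriv ξ j g) (dirDeriv ξ (j + 1) g x) x ξ := by
  rw [dirDeriv_succ]
  apply LineDifferentiableAt.hasLineDerivAt
  have h : Differentiable ℝ (iteratedDeriv j (fun t : ℝ => g (x + t • ξ))) :=
    (hg.2.1 x).differentiable_iteratedDeriv j (by exact_mod_cast WithTop.coe_lt_top _)
  have he : (fun t : ℝ => dirDeriv ξ j g (x + t • ξ)) =
      iteratedDeriv j (fun t : ℝ => g (x + t • ξ)) :=
    funext fun t => (iteratedDeriv_line ξ j g x t).symm
  rw [LineDifferentiableAt, he]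
  exact h 0

theorem DirSmooth.continuous_dirDeriv (hg : DirSmooth ξ g) (j : ℕ) :
    Continuous (dirDeriv ξ j g) := by
  rcases Nat.eq_zero_or_pos j with rfl | hj
  · simpa using hg.1
  · exact hg.2.2 j hj

theorem dirDeriv_succ_eq_fderiv {j : ℕ} (h : Differentiable ℝ (dirDeriv ξ j g)) :
    dirDeriv ξ (j + 1) g = fun x => fderiv ℝ (dirDeriv ξ j g) x ξ := by
  ext x
  rw [dirDeriv_succ, (h x).lineDeriv_eq_fderiv]

theorem contDiff_dirDeriv (hχ : ContDiff ℝ ∞ χ) (ξ : EuclideanSpace ℝ (Fin n)) (j : ℕ) :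
    ContDiff ℝ ∞ (dirDeriv ξ j χ) := by
  induction j with
  | zero => simpa using hχ
  | succ j ih =>
    rw [dirDeriv_succ_eq_fderiv (ih.differentiable (by simp))]
    exact (ih.fderiv_right (m := ∞) (by simp)).clm_apply contDiff_const

theorem dirSmooth_of_contDiff (hχ : ContDiff ℝ ∞ χ) (ξ : EuclideanSpace ℝ (Fin n)) :
    DirSmooth ξ χ :=
  ⟨hχ.continuous, fun _ => hχ.comp (by fun_prop), fun j _ => (contDiff_dirDeriv hχ ξ j).continuous⟩

theorem dirDeriv_eq_zero_of_notMem_tsupport {x : EuclideanSpace ℝ (Fin n)} (hx : x ∉ tsupport g)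
    (ξ : EuclideanSpace ℝ (Fin n)) (j : ℕ) : dirDeriv ξ j g x = 0 := by
  have hc : Tendsto (fun t : ℝ => x + t • ξ) (𝓝 0) (𝓝 x) := by
    have : Continuous (fun t : ℝ => x + t • ξ) := by fun_prop
    simpa using this.tendsto 0
  have h : (fun t : ℝ => g (x + t • ξ)) =ᶠ[𝓝 0] fun _ => (0 : ℝ) :=
    hc.eventually (notMem_tsupport_iff_eventuallyEq.1 hx)
  rw [dirDeriv, h.iteratedDeriv_eq]
  simp

theorem tsupport_dirDeriv_subset (ξ : EuclideanSpace ℝ (Fin n)) (j : ℕ) :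
    tsupport (dirDeriv ξ j g) ⊆ tsupport g :=
  closure_minimal (fun _ hx => by
    by_contra h
    exact hx (dirDeriv_eq_zero_of_notMem_tsupport h ξ j)) (isClosed_tsupport g)

theorem dirDeriv_mul (hχ : DirSmooth ξ χ) (hg : DirSmooth ξ g) (k : ℕ) :
    dirDeriv ξ k (fun x => χ x * g x) = fun x => ∑ j ∈ Finset.range (k + 1),
      (k.choose j : ℝ) * dirDeriv ξ j χ x * dirDeriv ξ (k - j) g x := by
  ext x
  exact iteratedDeriv_fun_mul (((hχ.2.1 x).of_le (by exact_mod_cast le_top)).contDiffAt)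
    (((hg.2.1 x).of_le (by exact_mod_cast le_top)).contDiffAt)

theorem DirSmooth.mul (hχ : DirSmooth ξ χ) (hg : DirSmooth ξ g) :
    DirSmooth ξ (fun x => χ x * g x) := by
  refine ⟨hχ.1.mul hg.1, fun x => (hχ.2.1 x).mul (hg.2.1 x), fun j _ => ?_⟩
  rw [dirDeriv_mul hχ hg]
  exact continuous_finsetSum _ fun i _ =>
    (continuous_const.mul (hχ.continuous_dirDeriv i)).mul (hg.continuous_dirDeriv (j - i))

end Directional

/-! ### Cutoffs by repeated convolution -/

section Cutoff

variable {n : ℕ}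

open scoped Convolution

theorem dirDeriv_convolution {φ g : EuclideanSpace ℝ (Fin n) → ℝ} (hφ : Continuous φ)
    (hg : ContDiff ℝ ∞ g) (hgc : HasCompactSupport g) (ξ : EuclideanSpace ℝ (Fin n)) (j : ℕ) :
    dirDeriv ξ j (φ ⋆[ContinuousLinearMap.lsmul ℝ ℝ, volume] g) =
      φ ⋆[ContinuousLinearMap.lsmul ℝ ℝ, volume] (dirDeriv ξ j g) := by
  induction j with
  | zero => simp
  | succ j ih =>
    have hj := contDiff_dirDeriv hg ξ j
    have hjc : HasCompactSupport (dirDeriv ξ j g) :=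
      hgc.mono' ((subset_tsupport _).trans (tsupport_dirDeriv_subset ξ j))
    ext x
    have hd := hjc.hasFDerivAt_convolution_right (ContinuousLinearMap.lsmul ℝ ℝ)
      (hφ.locallyIntegrable (μ := volume)) (hj.of_le (by exact_mod_cast le_top)) x
    rw [dirDeriv_succ, ih, hd.hasLineDerivAt ξ |>.lineDeriv,
      convolution_precompR_apply _ hφ.locallyIntegrable (hjc.fderiv ℝ)
        (hj.continuous_fderiv (by simp)), dirDeriv_succ_eq_fderiv (hj.differentiable (by simp))]

/-- One derivative falls on φ and the other j on g, so each convolution gains one controlled order.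
-/
theorem dirDeriv_succ_convolution {φ g : EuclideanSpace ℝ (Fin n) → ℝ} (hφ : ContDiff ℝ ∞ φ)
    (hφc : HasCompactSupport φ)
    (hg : ContDiff ℝ ∞ g) (hgc : HasCompactSupport g) (ξ : EuclideanSpace ℝ (Fin n)) (j : ℕ)
    (x : EuclideanSpace ℝ (Fin n)) :
    dirDeriv ξ (j + 1) (φ ⋆[ContinuousLinearMap.lsmul ℝ ℝ, volume] g) x =
      ∫ y, fderiv ℝ φ y ξ * dirDeriv ξ j g (x - y) := by
  have hj := contDiff_dirDeriv hg ξ j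
  have hd := hφc.hasFDerivAt_convolution_left (ContinuousLinearMap.lsmul ℝ ℝ)
    (hφ.of_le (by exact_mod_cast le_top)) (hj.continuous.locallyIntegrable (μ := volume)) x
  rw [dirDeriv_succ, dirDeriv_convolution hφ.continuous hg hgc, hd.hasLineDerivAt ξ |>.lineDeriv]
  have hjc : HasCompactSupport (dirDeriv ξ j g) :=
      hgc.mono' ((subset_tsupport _).trans (tsupport_dirDeriv_subset ξ j))
  have hce : ConvolutionExistsAt (fderiv ℝ φ) (dirDeriv ξ j g) x
      (ContinuousLinearMap.precompL (EuclideanSpace ℝ (Fin n)) (ContinuousLinearMap.lsmul ℝ ℝ))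
      volume :=
    (hφc.fderiv ℝ).convolutionExists_left _ (hφ.continuous_fderiv (by simp))
      hj.continuous.locallyIntegrable x
  refine (ContinuousLinearMap.integral_apply hce ξ).trans ?_
  simp [ContinuousLinearMap.precompL_apply]

/-- Cutoff functions with controlled derivatives up to a given order. -/
theorem exists_cutoff (n : ℕ) : ∃ C : ℝ, 0 ≤ C ∧ ∀ k : ℕ, 1 ≤ k → ∀ R : ℝ, 0 < R →
    ∃ χ : EuclideanSpace ℝ (Fin n) → ℝ, ContDiff ℝ ∞ χ ∧ (∀ x ∈ ball 0 R, χ x = 1) ∧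
      tsupport χ ⊆ closedBall 0 (4 * R) ∧
      ∀ j ≤ k, ∀ ξ x, |dirDeriv ξ j χ x| ≤ (C * ‖ξ‖ * k / R) ^ j := by
  let b : ContDiffBump (0 : EuclideanSpace ℝ (Fin n)) := ⟨1 / 2, 1, by norm_num, by norm_num⟩
  let φ := b.normed volume
  have hφ : ContDiff ℝ ∞ φ := b.contDiff_normed
  have hφc : HasCompactSupport φ := b.hasCompactSupport_normed
  have hdint : Integrable (fun y => ‖fderiv ℝ φ y‖) volume :=
    ((hφ.continuous_fderiv (by simp)).integrable_of_hasCompactSupport (hφc.fderiv ℝ)).norm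
  set C := ∫ y, ‖fderiv ℝ φ y‖ with hC
  have hC0 : 0 ≤ C := integral_nonneg fun _ => norm_nonneg _
  refine ⟨C, hC0, fun k hk => ?_⟩
  have hk0 : (1 : ℝ) ≤ k := by exact_mod_cast hk
  -- Convolving i times with a unit-radius mollifier gives control of i derivatives, each costing a
  -- factor C‖ξ‖; every convolution shrinks the region where g = 1, and enlarges the support, by 1.
  have key : ∀ i ≤ k, ∃ g : EuclideanSpace ℝ (Fin n) → ℝ, ContDiff ℝ ∞ g ∧
      (∀ x ∈ ball 0 (2 * k - i : ℝ), g x = 1) ∧ (∀ x, (3 * k + i : ℝ) < ‖x‖ → g x = 0) ∧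
      ∀ j ≤ i, ∀ ξ x, |dirDeriv ξ j g x| ≤ (C * ‖ξ‖) ^ j := by
    intro i
    induction i with
    | zero =>
      intro _
      let c : ContDiffBump (0 : EuclideanSpace ℝ (Fin n)) := ⟨2 * k, 3 * k, by linarith, by linarith⟩
      refine ⟨c, c.contDiff, fun x hx => c.one_of_mem_closedBall ?_, fun x hx =>
        c.zero_of_le_dist ?_, fun j hj ξ x => ?_⟩
      · exact ball_subset_closedBall (by simpa using hx)
      · simpa [c] using (by simpa using hx : (3 * k : ℝ) < ‖x‖).le
      · obtain rfl : j = 0 := by omega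
        simpa [abs_of_nonneg c.nonneg] using c.le_one
    | succ i ih =>
      intro hi
      obtain ⟨g, hg, h1, h0, hd⟩ := ih (by omega)
      have hgc : HasCompactSupport g :=
        HasCompactSupport.intro (isCompact_closedBall 0 (3 * k + i : ℝ)) fun x hx =>
          h0 x (by simpa using hx)
      have hnear : ∀ x y : EuclideanSpace ℝ (Fin n), y ∈ ball x b.rOut →
          ‖y - x‖ < 1 := fun x y hy => by
        have h : dist y x < 1 := hy
        rwa [dist_eq_norm] at h
      refine ⟨φ ⋆[ContinuousLinearMap.lsmul ℝ ℝ, volume] g,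
        hgc.contDiff_convolution_right _ hφ.continuous.locallyIntegrable hg,
        fun x hx => ?_, fun x hx => ?_, fun j hj ξ x => ?_⟩
      · have hx' : ‖x‖ < 2 * k - (i + 1) := by simpa using hx
        have hin : ∀ y ∈ ball x b.rOut, g y = 1 := fun y hy => h1 y (by
          have := hnear x y hy
          have := norm_le_norm_add_norm_sub' y x
          rw [mem_ball_zero_iff]; linarith)
        have hx1 : g x = 1 := hin x (mem_ball_self b.rOut_pos)
        rw [b.normed_convolution_eq_right (fun y hy => (hin y hy).trans hx1.symm), hx1]
      · push_cast at hx
        have hin : ∀ y ∈ ball x b.rOut, g y = 0 := fun y hy => h0 y (by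
          have := hnear x y hy
          have := norm_le_norm_add_norm_sub y x
          linarith)
        have hx1 : g x = 0 := hin x (mem_ball_self b.rOut_pos)
        rw [b.normed_convolution_eq_right (fun y hy => (hin y hy).trans hx1.symm), hx1]
      · rcases j with _ | j
        · have hg1 : ∀ y, ‖g y‖ ≤ 1 := fun y => by simpa using hd 0 (Nat.zero_le i) ξ y
          simp only [dirDeriv_zero, pow_zero]
          rw [convolution, ← Real.norm_eq_abs]
          calc _ ≤ ∫ y, φ y := norm_integral_le_of_norm_le b.integrable_normed (ae_of_all _ fun y => by
                have := b.nonneg_normed (μ := volume) y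
                rw [ContinuousLinearMap.lsmul_apply, norm_smul, Real.norm_of_nonneg this]
                exact mul_le_of_le_one_right this (hg1 _))
            _ = 1 := b.integral_normed
        · rw [dirDeriv_succ_convolution hφ hφc hg hgc, ← Real.norm_eq_abs]
          calc _ ≤ ∫ y, ‖fderiv ℝ φ y‖ * (‖ξ‖ * (C * ‖ξ‖) ^ j) :=
                norm_integral_le_of_norm_le (hdint.mul_const _) (ae_of_all _ fun y => by
                  rw [norm_mul, ← mul_assoc]
                  exact mul_le_mul (ContinuousLinearMap.le_opNorm _ _) (hd j (by omega) ξ _)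
                    (norm_nonneg _) (by positivity))
            _ = _ := by rw [integral_mul_const, ← hC, pow_succ]; ring
  intro R hR
  obtain ⟨g, hg, h1, h0, hd⟩ := key k le_rfl
  have hkR : 0 < k / R := by positivity
  -- After k convolutions the radii are k and 4k; the dilation makes them R and 4R and brings in the
  -- factor k / R per derivative.
  refine ⟨fun x => g ((k / R) • x), hg.comp (by fun_prop), fun x hx => h1 _ ?_,
    closure_minimal (fun x hx => ?_) isClosed_closedBall, fun j hj ξ x => ?_⟩
  · rw [mem_ball_zero_iff] at hx ⊢
    rw [norm_smul, Real.norm_of_nonneg hkR.le, div_mul_eq_mul_div, div_lt_iff₀ hR]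
    nlinarith
  · rw [mem_closedBall_zero_iff]
    by_contra! h
    refine hx (h0 _ ?_)
    rw [norm_smul, Real.norm_of_nonneg hkR.le, div_mul_eq_mul_div, lt_div_iff₀ hR]
    nlinarith
  · have : dirDeriv ξ j (fun x => g ((k / R) • x)) x = dirDeriv ((k / R) • ξ) j g ((k / R) • x) := by
      simp only [dirDeriv, smul_add, smul_comm (k / R)]
    rw [this]
    refine (hd j hj _ _).trans_eq ?_
    rw [norm_smul, Real.norm_of_nonneg hkR.le]
    ring

end Cutoff

/-! ### Determining sets and uniform ellipticity -/

section Determining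

variable {n m : ℕ} {Λ : Set (EuclideanSpace ℝ (Fin n) × EuclideanSpace ℝ (Fin m))}

theorem IsDetermining.exists_ne_zero (hΛ : IsDetermining Λ) {u : EuclideanSpace ℝ (Fin n)}
    {v : EuclideanSpace ℝ (Fin m)} (hu : u ≠ 0) (hv : v ≠ 0) :
    ∃ p ∈ Λ, inner ℝ u p.1 ≠ 0 ∧ inner ℝ v p.2 ≠ 0 := by
  by_contra! h
  refine hΛ ⟨(innerₗ _ u).smulRight (innerₗ _ v), ?_, fun p hp => ?_⟩
  · have hv' : innerₗ (EuclideanSpace ℝ (Fin m)) v ≠ 0 := fun h0 =>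
      hv ((inner_self_eq_zero (𝕜 := ℝ)).1 (LinearMap.congr_fun h0 v))
    have : LinearMap.range ((innerₗ (EuclideanSpace ℝ (Fin n)) u).smulRight
        (innerₗ (EuclideanSpace ℝ (Fin m)) v)) = Submodule.span ℝ {innerₗ _ v} := by
      ext w
      rw [LinearMap.mem_range, Submodule.mem_span_singleton]
      constructor
      · rintro ⟨x, rfl⟩
        exact ⟨_, rfl⟩
      · rintro ⟨c, rfl⟩
        refine ⟨(c / inner ℝ u u) • u, ?_⟩
        have : inner ℝ u u ≠ 0 := inner_self_ne_zero.2 hu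
        rw [LinearMap.smulRight_apply, innerₗ_apply_apply, inner_smul_right, div_mul_cancel₀ _ this]
    exact (LinearEquiv.ofEq _ _ this).finrank_eq.trans (finrank_span_singleton hv')
  · by_cases h1 : inner ℝ u p.1 = 0
    · simp [h1]
    · simp [h p hp h1]

/-- If ψ spans the range of φ and ψ η₀ ≠ 0, then φ x is the multiple of ψ by φ x η₀ / ψ η₀; so φ is,
up to a scalar, a product of two linear functionals, represented by u and v. -/
theorem exists_ne_zero_of_not_isDetermining (hΛ : ¬ IsDetermining Λ) :
    ∃ (u : EuclideanSpace ℝ (Fin n)) (v : EuclideanSpace ℝ (Fin m)), u ≠ 0 ∧ v ≠ 0 ∧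
      ∀ p ∈ Λ, inner ℝ u p.1 = 0 ∨ inner ℝ v p.2 = 0 := by
  rw [IsDetermining, not_not] at hΛ
  obtain ⟨φ, hφ, h0⟩ := hΛ
  obtain ⟨ψ, ⟨x₀, hx₀⟩, hψ0⟩ := Submodule.exists_mem_ne_zero_of_ne_bot
    (p := LinearMap.range φ) (fun h => by rw [h, finrank_bot] at hφ; omega)
  have hr : Submodule.span ℝ {ψ} = LinearMap.range φ := by
    refine Submodule.eq_of_le_of_finrank_eq ?_ ((finrank_span_singleton hψ0).trans hφ.symm)
    rw [Submodule.span_singleton_le_iff_mem]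
    exact ⟨x₀, hx₀⟩
  obtain ⟨η₀, hη₀⟩ : ∃ η, ψ η ≠ 0 := by
    by_contra! h
    exact hψ0 (LinearMap.ext h)
  let u := (InnerProductSpace.toDual ℝ _).symm (LinearMap.toContinuousLinearMap (φ.flip η₀))
  let v := (InnerProductSpace.toDual ℝ _).symm (LinearMap.toContinuousLinearMap ψ)
  have hu : ∀ x, inner ℝ u x = φ x η₀ := fun x => by
    simp only [u]; rw [InnerProductSpace.toDual_symm_apply]; rfl
  have hv : ∀ y, inner ℝ v y = ψ y := fun x => by
    simp only [v]; rw [InnerProductSpace.toDual_symm_apply]; rfl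
  refine ⟨u, v, fun h => hη₀ ?_, fun h => hη₀ ?_, fun p hp => ?_⟩
  · rw [← hx₀, ← hu, h, inner_zero_left]
  · rw [← hv, h, inner_zero_left]
  · obtain ⟨c, hc'⟩ := Submodule.mem_span_singleton.1 (hr ▸ LinearMap.mem_range_self φ p.1)
    have := h0 p hp
    rw [← hc', LinearMap.smul_apply, smul_eq_mul] at this
    rw [hu, hv, ← hc', LinearMap.smul_apply, smul_eq_mul]
    rcases mul_eq_zero.1 this with h | h
    · left; rw [h, zero_mul]
    · right; exact h

/-- Points of Λ act as evaluations in the finite-dimensional dual of the space of bilinear forms.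
Finitely many span all of them, so a form vanishing at these vanishes on Λ. -/
theorem IsDetermining.exists_finset (hΛ : IsDetermining Λ) :
    ∃ T : Finset (EuclideanSpace ℝ (Fin n) × EuclideanSpace ℝ (Fin m)),
      (T : Set (EuclideanSpace ℝ (Fin n) × EuclideanSpace ℝ (Fin m))) ⊆ Λ ∧
        IsDetermining (T : Set (EuclideanSpace ℝ (Fin n) × EuclideanSpace ℝ (Fin m))) := by
  classical
  let Φ : EuclideanSpace ℝ (Fin n) × EuclideanSpace ℝ (Fin m) →
      Module.Dual ℝ (EuclideanSpace ℝ (Fin n) →ₗ[ℝ] EuclideanSpace ℝ (Fin m) →ₗ[ℝ] ℝ) :=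
    fun p => (LinearMap.applyₗ p.2).comp (LinearMap.applyₗ p.1)
  obtain ⟨s, hs, hspan⟩ := (Submodule.fg_span_iff_fg_span_finset_subset (R := ℝ) (Φ '' Λ)).1
    (IsNoetherian.noetherian _)
  obtain ⟨T, hT, rfl⟩ := Finset.subset_set_image_iff.1 hs
  refine ⟨T, hT, ?_⟩
  rintro ⟨φ, hφ, h0⟩
  refine hΛ ⟨φ, hφ, fun p hp => ?_⟩
  have hle : Submodule.span ℝ ((T.image Φ : Finset _) : Set _) ≤
      LinearMap.ker (LinearMap.applyₗ (R := ℝ) (M₂ := ℝ) φ) := by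
    rw [Submodule.span_le]
    intro y hy
    obtain ⟨q, hq, rfl⟩ := Finset.mem_image.1 (Finset.mem_coe.1 hy)
    exact h0 q hq
  exact hle (hspan ▸ Submodule.subset_span (mem_image_of_mem Φ hp))

/-- Ellipticity: away from the hyperplanes `⟨ξ, ζ⟩ = 0` there are enough vectors `η`. -/
theorem IsDetermining.exists_coeff
    {T : Finset (EuclideanSpace ℝ (Fin n) × EuclideanSpace ℝ (Fin m))}
    (hT : IsDetermining (T : Set (EuclideanSpace ℝ (Fin n) × EuclideanSpace ℝ (Fin m)))) :
    ∃ c : ℝ, 0 < c ∧ ∃ D : ℝ, 0 ≤ D ∧ ∀ ζ : EuclideanSpace ℝ (Fin n), ζ ≠ 0 → ∀ i : Fin m,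
      ∃ a : EuclideanSpace ℝ (Fin n) × EuclideanSpace ℝ (Fin m) → ℝ,
        (∀ p ∈ T, |a p| ≤ D) ∧ (∀ p ∈ T, a p ≠ 0 → c * ‖ζ‖ ≤ |inner ℝ p.1 ζ|) ∧
        ∑ p ∈ T, a p • p.2 = EuclideanSpace.single i 1 := by
  classical
  -- Only finitely many S occur, so uniform constants need no compactness in ζ. Either the η from S
  -- span, or some v ≠ 0 is orthogonal to them and then the ξ outside S must separate points.
  have key : ∀ S ∈ T.powerset, ∃ c : ℝ, 0 < c ∧ ∃ D : ℝ, 0 ≤ D ∧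
      ((∀ i : Fin m, ∃ a : EuclideanSpace ℝ (Fin n) × EuclideanSpace ℝ (Fin m) → ℝ,
        (∀ p ∈ T, |a p| ≤ D) ∧ (∀ p, a p ≠ 0 → p ∈ S) ∧
          ∑ p ∈ T, a p • p.2 = EuclideanSpace.single i 1) ∨
        ∀ ζ : EuclideanSpace ℝ (Fin n), ζ ≠ 0 → ∃ p ∈ T, p ∉ S ∧ c * ‖ζ‖ ≤ |inner ℝ p.1 ζ|) := by
    intro S hS
    rw [Finset.mem_powerset] at hS
    by_cases hspan : Submodule.span ℝ (Prod.snd '' (S : Set (EuclideanSpace ℝ (Fin n) ×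
      EuclideanSpace ℝ (Fin m)))) = ⊤
    · have hex : ∀ i : Fin m, ∃ b : EuclideanSpace ℝ (Fin n) × EuclideanSpace ℝ (Fin m) → ℝ,
          ∑ p ∈ S, b p • p.2 = EuclideanSpace.single i 1 := fun i =>
        (Submodule.mem_span_image_finset_iff_exists_fun' ℝ).1 (hspan ▸ Submodule.mem_top)
      choose b hb using hex
      refine ⟨1, one_pos, ∑ i, ∑ p ∈ T, |b i p|,
        Finset.sum_nonneg fun _ _ => Finset.sum_nonneg fun _ _ => abs_nonneg _, Or.inl fun i =>
        ⟨fun p => if p ∈ S then b i p else 0, fun p hp => ?_, fun p hp => ?_, ?_⟩⟩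
      · have h1 : |b i p| ≤ ∑ i, ∑ p ∈ T, |b i p| :=
          (Finset.single_le_sum (f := fun p => |b i p|) (fun _ _ => abs_nonneg _) hp).trans
            (Finset.single_le_sum (f := fun i => ∑ p ∈ T, |b i p|)
              (fun _ _ => Finset.sum_nonneg fun _ _ => abs_nonneg _) (Finset.mem_univ i))
        by_cases hpS : p ∈ S
        · simpa [hpS] using h1
        · simpa [hpS] using (abs_nonneg _).trans h1
      · by_contra h
        simp [h] at hp
      · rw [← hb i, ← Finset.sum_subset hS (fun p _ hpS => by simp [hpS])]
        exact Finset.sum_congr rfl fun p hp => by simp [hp]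
    · obtain ⟨v, hv, hv0⟩ := Submodule.exists_mem_ne_zero_of_ne_bot
        (mt Submodule.orthogonal_eq_bot_iff.1 hspan)
      have hvS : ∀ p ∈ S, inner ℝ v p.2 = 0 := fun p hp => by
        rw [real_inner_comm]
        exact (Submodule.mem_orthogonal _ v).1 hv _ (Submodule.subset_span (mem_image_of_mem _ hp))
      let L : EuclideanSpace ℝ (Fin n) →ₗ[ℝ] (↥(T \ S) → ℝ) :=
        LinearMap.pi fun p => innerₗ _ p.1.1
      have hL : LinearMap.ker L = ⊥ := by
        rw [LinearMap.ker_eq_bot']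
        intro u hu
        by_contra hu0
        obtain ⟨p, hp, h1, h2⟩ := hT.exists_ne_zero hu0 hv0
        have hpS : p ∉ S := fun h => h2 (hvS p h)
        have := congrFun hu ⟨p, Finset.mem_sdiff.2 ⟨hp, hpS⟩⟩
        exact h1 (by rw [real_inner_comm]; simpa [L] using this)
      obtain ⟨K, hK, hanti⟩ := L.exists_antilipschitzWith hL
      have hK' : (0 : ℝ) < K := hK
      refine ⟨(K : ℝ)⁻¹, by positivity, 0, le_rfl, Or.inr fun ζ hζ => ?_⟩
      by_contra! h
      have hζ' : 0 < ‖ζ‖ := norm_pos_iff.2 hζ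
      have hlt : ‖L ζ‖ < (K : ℝ)⁻¹ * ‖ζ‖ := by
        rw [pi_norm_lt_iff (by positivity)]
        intro p
        have := Finset.mem_sdiff.1 p.2
        simpa [L] using h p.1 this.1 this.2
      have hle : ‖ζ‖ ≤ K * ‖L ζ‖ := by
        simpa using hanti.le_mul_dist ζ 0
      rw [← div_eq_inv_mul, lt_div_iff₀ hK'] at hlt
      linarith
  choose! c hc D hD h using key
  have hne : T.powerset.Nonempty := ⟨∅, Finset.empty_mem_powerset T⟩
  refine ⟨T.powerset.inf' hne c, (Finset.lt_inf'_iff hne).2 hc, ∑ S ∈ T.powerset, D S,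
    Finset.sum_nonneg hD, fun ζ hζ i => ?_⟩
  set c₀ := T.powerset.inf' hne c with hc₀
  -- For this S the second alternative would give a p outside S satisfying the inequality that
  -- defines S.
  let S := T.filter fun p => c₀ * ‖ζ‖ ≤ |inner ℝ p.1 ζ|
  have hS : S ∈ T.powerset := Finset.mem_powerset.2 (Finset.filter_subset _ _)
  rcases h S hS with hgood | hbad
  · obtain ⟨a, ha, haS, hsum⟩ := hgood i
    exact ⟨a, fun p hp => (ha p hp).trans (Finset.single_le_sum hD hS),
      fun p _ hp => (Finset.mem_filter.1 (haS p hp)).2, hsum⟩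
  · obtain ⟨p, hp, hpS, hle⟩ := hbad ζ hζ
    refine (hpS (Finset.mem_filter.2 ⟨hp, le_trans ?_ hle⟩)).elim
    gcongr
    exact Finset.inf'_le _ hS

end Determining

/-! ### Directional derivatives and Fourier decay -/

section Fourier

open scoped FourierTransform
open Real (pi_pos)

variable {n : ℕ}

/-- Integration by parts along ξ against the exponential: f need be differentiable in that direction
only. -/
theorem fourier_lineDeriv {f f' : EuclideanSpace ℝ (Fin n) → ℂ} {ξ : EuclideanSpace ℝ (Fin n)}
    (hf : Continuous f) (hfc : HasCompactSupport f) (hf' : Continuous f')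
    (hfc' : HasCompactSupport f') (h : ∀ x, HasLineDerivAt ℝ f (f' x) x ξ)
    (ζ : EuclideanSpace ℝ (Fin n)) :
    𝓕 f' ζ = (2 * Real.pi * inner ℝ ξ ζ * Complex.I : ℂ) * 𝓕 f ζ := by
  let e : EuclideanSpace ℝ (Fin n) → ℂ :=
    fun x => Complex.exp ((-2 * Real.pi * inner ℝ x ζ : ℝ) * Complex.I)
  let e' : EuclideanSpace ℝ (Fin n) → ℂ :=
    fun x => -(2 * Real.pi * inner ℝ ξ ζ * Complex.I : ℂ) * e x
  have he : Continuous e := by fun_prop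
  have he' : Continuous e' := by fun_prop
  have hde : ∀ x, HasLineDerivAt ℝ e (e' x) x ξ := by
    intro x
    have h1 : HasDerivAt (fun t : ℝ => -2 * Real.pi * inner ℝ (x + t • ξ) ζ)
        (-2 * Real.pi * inner ℝ ξ ζ) 0 := by
      have : (fun t : ℝ => -2 * Real.pi * inner ℝ (x + t • ξ) ζ) =
          fun t : ℝ => -2 * Real.pi * (inner ℝ x ζ + t * inner ℝ ξ ζ) := by
        ext t; rw [inner_add_left, real_inner_smul_left]
      rw [this]
      simpa using (((hasDerivAt_id (0 : ℝ)).mul_const (inner ℝ ξ ζ)).const_add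
        (inner ℝ x ζ)).const_mul (-2 * Real.pi)
    have h2 := (h1.ofReal_comp.mul_const Complex.I).cexp
    refine HasDerivAt.congr_deriv h2 ?_
    simp only [e', e, zero_smul, add_zero]
    push_cast
    ring
  have hint : ∀ {a b : EuclideanSpace ℝ (Fin n) → ℂ}, Continuous a → Continuous b →
      HasCompactSupport b → Integrable (fun x => ContinuousLinearMap.mul ℝ ℂ (a x) (b x)) := by
    intro a b ha hb hbc
    exact (ha.mul hb).integrable_of_hasCompactSupport hbc.mul_left
  have key := integral_bilinear_hasLineDerivAt_right_eq_neg_left_of_integrable (μ := volume)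
    (B := ContinuousLinearMap.mul ℝ ℂ) (hint he' hf hfc) (hint he hf' hfc') (hint he hf hfc)
    (fun x _ => hde x) (fun x _ => h x)
  rw [Real.fourier_eq', Real.fourier_eq']
  simp only [ContinuousLinearMap.mul_apply', e'] at key
  simp only [smul_eq_mul]
  rw [key, ← integral_neg, ← integral_const_mul]
  congr 1
  ext x
  simp only [e]
  ring

theorem norm_fourier_le {f : EuclideanSpace ℝ (Fin n) → ℂ} {ρ N : ℝ}
    (hsupp : ∀ x, x ∉ closedBall (0 : EuclideanSpace ℝ (Fin n)) ρ → f x = 0)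
    (hN : ∀ x, ‖f x‖ ≤ N) (ζ : EuclideanSpace ℝ (Fin n)) :
    ‖𝓕 f ζ‖ ≤ N * volume.real (closedBall (0 : EuclideanSpace ℝ (Fin n)) ρ) := by
  rw [Real.fourier_eq', ← setIntegral_eq_integral_of_forall_compl_eq_zero
    (s := closedBall (0 : EuclideanSpace ℝ (Fin n)) ρ) (fun x hx => by rw [hsupp x hx, smul_zero])]
  refine norm_setIntegral_le_of_norm_le_const measure_closedBall_lt_top fun x _ => ?_
  rw [norm_smul, Complex.norm_exp_ofReal_mul_I, one_mul]
  exact hN x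

theorem fourier_dirDeriv {G : EuclideanSpace ℝ (Fin n) → ℝ} {ξ : EuclideanSpace ℝ (Fin n)}
    (hG : DirSmooth ξ G) (hGc : HasCompactSupport G) (k : ℕ) (ζ : EuclideanSpace ℝ (Fin n)) :
    𝓕 (fun x => (dirDeriv ξ k G x : ℂ)) ζ =
      (2 * Real.pi * inner ℝ ξ ζ * Complex.I : ℂ) ^ k * 𝓕 (fun x => (G x : ℂ)) ζ := by
  have hcs : ∀ j, HasCompactSupport (fun x => (dirDeriv ξ j G x : ℂ)) := fun j =>
    (hGc.mono' ((subset_tsupport _).trans (tsupport_dirDeriv_subset ξ j))).comp_left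
      (g := ((↑) : ℝ → ℂ)) Complex.ofReal_zero
  have hc : ∀ j, Continuous (fun x => (dirDeriv ξ j G x : ℂ)) := fun j =>
    Complex.continuous_ofReal.comp (hG.continuous_dirDeriv j)
  induction k with
  | zero => simp
  | succ k ih =>
    rw [fourier_lineDeriv (hc k) (hcs k) (hc (k + 1)) (hcs (k + 1))
      (fun x => HasDerivAt.ofReal_comp (hG.hasLineDerivAt k x)), ih, pow_succ]
    ring

theorem pow_mul_norm_fourier_le {G : EuclideanSpace ℝ (Fin n) → ℝ} {ξ : EuclideanSpace ℝ (Fin n)}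
    (hG : DirSmooth ξ G) {ρ : ℝ} (hsupp : tsupport G ⊆ closedBall 0 ρ) {k : ℕ} {N : ℝ}
    (hN : ∀ x, |dirDeriv ξ k G x| ≤ N) (ζ : EuclideanSpace ℝ (Fin n)) :
    |inner ℝ ξ ζ| ^ k * ‖𝓕 (fun x => (G x : ℂ)) ζ‖ ≤
      N * volume.real (closedBall (0 : EuclideanSpace ℝ (Fin n)) ρ) := by
  have hGc : HasCompactSupport G := (isCompact_closedBall _ _).of_isClosed_subset
    (isClosed_tsupport G) hsupp
  have h := norm_fourier_le (f := fun x => (dirDeriv ξ k G x : ℂ)) (ρ := ρ) (N := N)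
    (fun x hx => by rw [dirDeriv_eq_zero_of_notMem_tsupport (fun h => hx (hsupp h))]; simp)
    (fun x => by simpa using hN x) ζ
  rw [fourier_dirDeriv hG hGc, norm_mul, norm_pow] at h
  refine le_trans ?_ h
  gcongr
  simp only [norm_mul, Complex.norm_I, mul_one, Complex.norm_real, Real.norm_eq_abs,
    Complex.norm_ofNat, abs_of_pos pi_pos]
  have : 1 ≤ 2 * Real.pi := by linarith [Real.pi_gt_three]
  nlinarith [abs_nonneg (inner ℝ ξ ζ)]

/-- Smoothness from decay of the Fourier transform, with a bound on the derivative. -/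
theorem contDiff_of_fourier_decay {F : EuclideanSpace ℝ (Fin n) → ℂ} (hF : Continuous F)
    (hFc : HasCompactSupport F) {l : ℕ} {B₀ B₁ : ℝ} (h0 : ∀ ζ, ‖𝓕 F ζ‖ ≤ B₀)
    (h1 : ∀ ζ, ‖ζ‖ ^ (l + n + 1) * ‖𝓕 F ζ‖ ≤ B₁) :
    ContDiff ℝ l F ∧ ∀ x, ‖iteratedFDeriv ℝ l F x‖ ≤ (2 * Real.pi) ^ l *
      (2 ^ (n + 1) * (B₀ + B₁) *
        ∫ ζ : EuclideanSpace ℝ (Fin n), (1 + ‖ζ‖) ^ (-(n + 1 : ℝ))) := by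
  have hFi : Integrable F := hF.integrable_of_hasCompactSupport hFc
  have hFt : Continuous (𝓕 F) :=
    VectorFourier.fourierIntegral_continuous Real.continuous_fourierChar (L := innerₗ _)
      continuous_inner hFi
  have hI : Integrable (fun ζ : EuclideanSpace ℝ (Fin n) => (1 + ‖ζ‖) ^ (-(n + 1 : ℝ))) :=
    integrable_one_add_norm (by simp)
  have hB0 : 0 ≤ B₀ := (norm_nonneg _).trans (h0 0)
  have hB1 : 0 ≤ B₁ := (by positivity : (0 : ℝ) ≤ _).trans (h1 0)
  -- B₀ serves for ‖ζ‖ ≤ 1 and B₁ for ‖ζ‖ ≥ 1; the n + 1 spare powers of ‖ζ‖ provide the integrable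
  -- weight.
  have hpt : ∀ j ≤ l, ∀ ζ : EuclideanSpace ℝ (Fin n), ‖ζ‖ ^ j * ‖𝓕 F ζ‖ ≤
      2 ^ (n + 1) * (B₀ + B₁) * (1 + ‖ζ‖) ^ (-(n + 1 : ℝ)) := by
    intro j hj ζ
    have hpos : (0 : ℝ) < (1 + ‖ζ‖) ^ (n + 1) := by positivity
    have hrw : (1 + ‖ζ‖) ^ (-(n + 1 : ℝ)) = ((1 + ‖ζ‖) ^ (n + 1))⁻¹ := by
      rw [Real.rpow_neg (by positivity)]
      norm_cast
    rw [hrw, ← div_eq_mul_inv, le_div_iff₀ hpos]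
    rcases le_total ‖ζ‖ 1 with hζ | hζ
    · calc ‖ζ‖ ^ j * ‖𝓕 F ζ‖ * (1 + ‖ζ‖) ^ (n + 1) ≤ 1 * B₀ * 2 ^ (n + 1) := by
            gcongr
            · exact pow_le_one₀ (norm_nonneg _) hζ
            · exact h0 ζ
            · linarith
        _ ≤ _ := by nlinarith [pow_pos (two_pos (α := ℝ)) (n + 1)]
    · calc ‖ζ‖ ^ j * ‖𝓕 F ζ‖ * (1 + ‖ζ‖) ^ (n + 1) ≤
            ‖ζ‖ ^ l * ‖𝓕 F ζ‖ * (2 * ‖ζ‖) ^ (n + 1) := by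
            gcongr
            linarith
        _ = 2 ^ (n + 1) * (‖ζ‖ ^ (l + n + 1) * ‖𝓕 F ζ‖) := by ring
        _ ≤ 2 ^ (n + 1) * (B₀ + B₁) := by
            gcongr
            linarith [h1 ζ]
  have hint : ∀ j : ℕ, (j : ℕ∞) ≤ (l : ℕ∞) → Integrable (fun ζ => ‖ζ‖ ^ j * ‖𝓕 F ζ‖) := by
    intro j hj
    refine (hI.const_mul (2 ^ (n + 1) * (B₀ + B₁))).mono' (by fun_prop) (ae_of_all _ fun ζ => ?_)
    rw [Real.norm_of_nonneg (by positivity)]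
    exact hpt j (by exact_mod_cast hj) ζ
  have hFti : Integrable (𝓕 F) := by
    rw [← integrable_norm_iff hFt.aestronglyMeasurable]
    simpa using hint 0 (by simp)
  -- Inversion as a double transform up to reflection lets the derivatives of F be read off from
  -- moments of 𝓕 F.
  have hinv : F = (𝓕 (𝓕 F)) ∘ (LinearIsometryEquiv.neg ℝ (E := EuclideanSpace ℝ (Fin n))) := by
    conv_lhs => rw [← hF.fourierInv_fourier_eq hFi hFti]
    ext x
    rw [Real.fourierInv_eq_fourier_neg]
    rfl
  have hcd : ContDiff ℝ l (𝓕 (𝓕 F)) := Real.contDiff_fourier (N := (l : ℕ∞)) hint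
  constructor
  · rw [hinv]
    exact hcd.comp (LinearIsometryEquiv.contDiff _)
  · intro x
    rw [hinv, LinearIsometryEquiv.norm_iteratedFDeriv_comp_right,
      Real.iteratedFDeriv_fourier (N := (l : ℕ∞)) hint hFt.aestronglyMeasurable le_rfl,
      Real.fourier_eq', ← integral_const_mul, ← integral_const_mul]
    refine norm_integral_le_of_norm_le ((hI.const_mul _).const_mul _) (ae_of_all _ fun ζ => ?_)
    rw [norm_smul, Complex.norm_exp_ofReal_mul_I, one_mul]
    refine (VectorFourier.norm_fourierPowSMulRight_le _ _ _ _).trans ?_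
    rw [mul_assoc]
    have : 2 * Real.pi * ‖innerSL ℝ (E := EuclideanSpace ℝ (Fin n))‖ ≤ 2 * Real.pi :=
      mul_le_of_le_one_right (by positivity) (norm_innerSL_le ℝ)
    exact mul_le_mul (pow_le_pow_left₀ (by positivity) this l) (hpt l le_rfl ζ) (by positivity)
      (by positivity)

end Fourier

/-! ### Inequalities for the weight sequence -/

section Weight

variable {M : ℕ → ℝ}

theorem weight_pow_le (hM0 : M 0 = 1) (hMfac : ∀ k : ℕ, (k.factorial : ℝ) ≤ M k)
    (hMinc : ∀ j k : ℕ, 1 ≤ j → j < k → M j ^ (1 / (j : ℝ)) < M k ^ (1 / (k : ℝ)))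
    {i k : ℕ} (hik : i ≤ k) : M i ^ k ≤ M k ^ i := by
  have hpos : ∀ k, 0 ≤ M k := fun k => le_trans (by positivity) (hMfac k)
  rcases Nat.eq_zero_or_pos i with rfl | hi
  · simp [hM0]
  rcases hik.eq_or_lt with rfl | hlt
  · rfl
  have h := (hMinc i k hi hlt).le
  have h1 : (M i ^ (1 / (i : ℝ))) ^ i = M i := by
    rw [one_div]; exact Real.rpow_inv_natCast_pow (hpos i) (by omega)
  have h2 : (M k ^ (1 / (k : ℝ))) ^ k = M k := by
    rw [one_div]; exact Real.rpow_inv_natCast_pow (hpos k) (by omega)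
  calc M i ^ k = (M i ^ (1 / (i : ℝ))) ^ (i * k) := by rw [pow_mul, h1]
    _ ≤ (M k ^ (1 / (k : ℝ))) ^ (i * k) :=
      pow_le_pow_left₀ (Real.rpow_nonneg (hpos i) _) h _
    _ = M k ^ i := by rw [mul_comm, pow_mul, h2]

/-- Compare k-th powers: M_{k-j}ᵏ ≤ M_kᵏ⁻ʲ by monotonicity of the roots, and kᵏ ≤ eᵏ k! ≤ eᵏ M_k. -/
theorem weight_mul_pow_le (hM0 : M 0 = 1) (hMfac : ∀ k : ℕ, (k.factorial : ℝ) ≤ M k)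
    (hMinc : ∀ j k : ℕ, 1 ≤ j → j < k → M j ^ (1 / (j : ℝ)) < M k ^ (1 / (k : ℝ)))
    {j k : ℕ} (hk : 1 ≤ k) (hjk : j ≤ k) : M (k - j) * k ^ j ≤ Real.exp 1 ^ j * M k := by
  have hpos : ∀ k, 0 ≤ M k := fun k => le_trans (by positivity) (hMfac k)
  refine le_of_pow_le_pow_left₀ (n := k) (by omega)
    (mul_nonneg (by positivity) (hpos k)) ?_
  have hkk : (k : ℝ) ^ k ≤ Real.exp 1 ^ k * M k := by
    have h := Real.pow_div_factorial_le_exp (x := k) (by positivity) k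
    rw [div_le_iff₀ (by positivity)] at h
    rw [← Real.exp_nat_mul, mul_one]
    exact h.trans (mul_le_mul_of_nonneg_left (hMfac k) (Real.exp_pos _).le)
  calc (M (k - j) * k ^ j) ^ k = M (k - j) ^ k * (k ^ k) ^ j := by ring
    _ ≤ M k ^ (k - j) * (Real.exp 1 ^ k * M k) ^ j :=
      mul_le_mul (weight_pow_le hM0 hMfac hMinc (Nat.sub_le k j))
        (pow_le_pow_left₀ (by positivity) hkk j) (by positivity) (pow_nonneg (hpos k) _)
    _ = Real.exp 1 ^ (j * k) * (M k ^ (k - j) * M k ^ j) := by ring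
    _ = (Real.exp 1 ^ j * M k) ^ k := by
      rw [← pow_add, Nat.sub_add_cancel hjk]; ring

theorem exists_weight_add_le (hpos : ∀ k, 0 ≤ M k)
    (hMdiff : ∃ C : ℝ, 0 < C ∧ ∀ k : ℕ, M (k + 1) ≤ C ^ k * M k) (s : ℕ) :
    ∃ P : ℝ, 1 ≤ P ∧ ∀ l, M (l + s) ≤ P ^ (l + 1) * M l := by
  obtain ⟨C, hC, h⟩ := hMdiff
  induction s with
  | zero => exact ⟨1, le_rfl, fun l => by simp⟩
  | succ s ih =>
    obtain ⟨P, hP, hl⟩ := ih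
    have hm : 1 ≤ max C 1 := le_max_right _ _
    refine ⟨max C 1 ^ (s + 1) * P, one_le_mul_of_one_le_of_one_le (one_le_pow₀ hm) hP, fun l => ?_⟩
    calc M (l + (s + 1)) ≤ C ^ (l + s) * M (l + s) := h (l + s)
      _ ≤ max C 1 ^ ((s + 1) * (l + 1)) * (P ^ (l + 1) * M l) := by
        refine mul_le_mul ?_ (hl l) (hpos _) (by positivity)
        calc C ^ (l + s) ≤ max C 1 ^ (l + s) := pow_le_pow_left₀ hC.le (le_max_left _ _) _
          _ ≤ _ := pow_le_pow_right₀ hm (by nlinarith)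
      _ = _ := by rw [mul_pow, ← pow_mul]; ring

/-- After `weight_mul_pow_le` the Leibniz sum is dominated by the binomial expansion of (e a + h)ᵏ.
-/
theorem abs_dirDeriv_mul_le (hM0 : M 0 = 1) (hMfac : ∀ k : ℕ, (k.factorial : ℝ) ≤ M k)
    (hMinc : ∀ j k : ℕ, 1 ≤ j → j < k → M j ^ (1 / (j : ℝ)) < M k ^ (1 / (k : ℝ)))
    {n : ℕ} {χ g : EuclideanSpace ℝ (Fin n) → ℝ} {ξ x : EuclideanSpace ℝ (Fin n)}
    (hχ : DirSmooth ξ χ) (hg : DirSmooth ξ g) {k : ℕ} (hk : 1 ≤ k) {a h A : ℝ} (ha : 0 ≤ a)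
    (hh : 0 ≤ h) (hA : 0 ≤ A) (h1 : ∀ j ≤ k, |dirDeriv ξ j χ x| ≤ (a * k) ^ j)
    (h2 : ∀ j ≤ k, |dirDeriv ξ j g x| ≤ A * (h ^ j * M j)) :
    |dirDeriv ξ k (fun x => χ x * g x) x| ≤ A * ((Real.exp 1 * a + h) ^ k * M k) := by
  have hpos : ∀ k, 0 ≤ M k := fun k => le_trans (by positivity) (hMfac k)
  rw [dirDeriv_mul hχ hg, add_pow, Finset.sum_mul, Finset.mul_sum]
  refine (Finset.abs_sum_le_sum_abs _ _).trans (Finset.sum_le_sum fun j hj => ?_)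
  have hjk : j ≤ k := by simpa [Nat.lt_succ_iff] using hj
  rw [abs_mul, abs_mul, Nat.abs_cast]
  calc (k.choose j : ℝ) * |dirDeriv ξ j χ x| * |dirDeriv ξ (k - j) g x|
      ≤ (k.choose j : ℝ) * (a * k) ^ j * (A * (h ^ (k - j) * M (k - j))) := by
        gcongr
        · exact h1 j hjk
        · exact h2 _ (Nat.sub_le k j)
    _ = (k.choose j : ℝ) * a ^ j * A * h ^ (k - j) * (M (k - j) * k ^ j) := by ring
    _ ≤ (k.choose j : ℝ) * a ^ j * A * h ^ (k - j) * (Real.exp 1 ^ j * M k) := by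
        exact mul_le_mul_of_nonneg_left (weight_mul_pow_le hM0 hMfac hMinc hk hjk) (by positivity)
    _ = _ := by ring

end Weight

/-! ### From directional to full regularity -/

section Regularity

open scoped FourierTransform

variable {n m : ℕ} {T : Finset (EuclideanSpace ℝ (Fin n) × EuclideanSpace ℝ (Fin m))}
  {f : EuclideanSpace ℝ (Fin n) → EuclideanSpace ℝ (Fin m)}

theorem apply_eq_sum_of_coeff {a : EuclideanSpace ℝ (Fin n) × EuclideanSpace ℝ (Fin m) → ℝ}
    {i : Fin m} (h : ∑ p ∈ T, a p • p.2 = EuclideanSpace.single i 1)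
    (y : EuclideanSpace ℝ (Fin m)) : y i = ∑ p ∈ T, a p * inner ℝ p.2 y := by
  have h1 : inner ℝ (EuclideanSpace.single i (1 : ℝ)) y = y i := by
    simp [EuclideanSpace.inner_single_left]
  rw [← h1, ← h, sum_inner]
  exact Finset.sum_congr rfl fun p _ => real_inner_smul_left _ _ _

theorem IsDetermining.continuous
    (hT : IsDetermining (T : Set (EuclideanSpace ℝ (Fin n) × EuclideanSpace ℝ (Fin m))))
    (hf : ∀ p ∈ T, Continuous fun x => inner ℝ p.2 (f x)) (i : Fin m) :
    Continuous fun x => f x i := by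
  rcases subsingleton_or_nontrivial (EuclideanSpace ℝ (Fin n)) with hs | hs
  · exact continuous_of_const fun x y => by rw [Subsingleton.elim x y]
  · obtain ⟨c, -, D, -, h⟩ := hT.exists_coeff
    obtain ⟨ζ, hζ⟩ := exists_ne (0 : EuclideanSpace ℝ (Fin n))
    obtain ⟨a, -, -, ha⟩ := h ζ hζ i
    simp only [apply_eq_sum_of_coeff ha]
    exact continuous_finsetSum _ fun p hp => continuous_const.mul (hf p hp)

/-- The coefficients depend on ζ, but at a fixed ζ they are constants and commute with the Fourier
integral; where a p ≠ 0, ‖ζ‖ is at most c⁻¹|⟨ξ, ζ⟩|. -/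
theorem pow_mul_norm_fourier_coord_le {c D : ℝ} (hc : 0 < c) (hD : 0 ≤ D)
    (hcoef : ∀ ζ : EuclideanSpace ℝ (Fin n), ζ ≠ 0 → ∀ i : Fin m,
      ∃ a : EuclideanSpace ℝ (Fin n) × EuclideanSpace ℝ (Fin m) → ℝ,
        (∀ p ∈ T, |a p| ≤ D) ∧ (∀ p ∈ T, a p ≠ 0 → c * ‖ζ‖ ≤ |inner ℝ p.1 ζ|) ∧
        ∑ p ∈ T, a p • p.2 = EuclideanSpace.single i 1)
    (hf : ∀ p ∈ T, DirSmooth p.1 (fun x => inner ℝ p.2 (f x)))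
    {χ : EuclideanSpace ℝ (Fin n) → ℝ} (hχ : ContDiff ℝ ∞ χ) {ρ : ℝ}
    (hsupp : tsupport χ ⊆ closedBall 0 ρ) {k : ℕ} (hk : 1 ≤ k) {N : ℝ} (hN0 : 0 ≤ N)
    (hN : ∀ p ∈ T, ∀ x, |dirDeriv p.1 k (fun x => χ x * inner ℝ p.2 (f x)) x| ≤ N)
    (i : Fin m) (ζ : EuclideanSpace ℝ (Fin n)) :
    ‖ζ‖ ^ k * ‖𝓕 (fun x => ((χ x * f x i : ℝ) : ℂ)) ζ‖ ≤ T.card * (D * (c⁻¹ ^ k *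
      (N * volume.real (closedBall (0 : EuclideanSpace ℝ (Fin n)) ρ)))) := by
  rcases eq_or_ne ζ 0 with rfl | hζ
  · rw [norm_zero, zero_pow (by omega), zero_mul]
    positivity
  obtain ⟨a, haD, hac, ha⟩ := hcoef ζ hζ i
  have hG : ∀ p ∈ T, DirSmooth p.1 (fun x => χ x * inner ℝ p.2 (f x)) := fun p hp =>
    (dirSmooth_of_contDiff hχ p.1).mul (hf p hp)
  have hGs : ∀ p : EuclideanSpace ℝ (Fin n) × EuclideanSpace ℝ (Fin m),
      tsupport (fun x => χ x * inner ℝ p.2 (f x)) ⊆ closedBall 0 ρ := fun p =>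
    (tsupport_mul_subset_left).trans hsupp
  have hsum : 𝓕 (fun x => ((χ x * f x i : ℝ) : ℂ)) ζ =
      ∑ p ∈ T, (a p : ℂ) * 𝓕 (fun x => ((χ x * inner ℝ p.2 (f x) : ℝ) : ℂ)) ζ := by
    simp only [Real.fourier_eq', smul_eq_mul, ← integral_const_mul]
    rw [← integral_finsetSum]
    · congr 1
      ext x
      rw [apply_eq_sum_of_coeff ha (f x)]
      push_cast
      rw [Finset.mul_sum, Finset.mul_sum]
      exact Finset.sum_congr rfl fun p _ => by ring
    · intro p hp
      refine Integrable.const_mul (Continuous.integrable_of_hasCompactSupport ?_ ?_) _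
      · have := (hG p hp).1
        fun_prop
      · refine HasCompactSupport.mul_left (HasCompactSupport.comp_left (g := ((↑) : ℝ → ℂ)) ?_
          Complex.ofReal_zero)
        exact (isCompact_closedBall _ _).of_isClosed_subset (isClosed_tsupport _) (hGs p)
  rw [hsum]
  calc ‖ζ‖ ^ k * ‖∑ p ∈ T, (a p : ℂ) * 𝓕 (fun x => ((χ x * inner ℝ p.2 (f x) : ℝ) : ℂ)) ζ‖
      ≤ ‖ζ‖ ^ k * ∑ p ∈ T, ‖(a p : ℂ) * 𝓕 (fun x => ((χ x * inner ℝ p.2 (f x) : ℝ) : ℂ)) ζ‖ := by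
        gcongr
        exact norm_sum_le _ _
    _ = ∑ p ∈ T, ‖ζ‖ ^ k * ‖(a p : ℂ) * 𝓕 (fun x => ((χ x * inner ℝ p.2 (f x) : ℝ) : ℂ)) ζ‖ :=
        Finset.mul_sum _ _ _
    _ ≤ _ := by
        rw [← nsmul_eq_mul]
        refine Finset.sum_le_card_nsmul _ _ _ fun p hp => ?_
        rw [norm_mul, Complex.norm_real, Real.norm_eq_abs]
        by_cases hap : a p = 0
        · rw [hap, abs_zero, zero_mul, mul_zero]
          positivity
        have hle : ‖ζ‖ ≤ c⁻¹ * |inner ℝ p.1 ζ| := by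
          rw [← div_eq_inv_mul, le_div_iff₀ hc, mul_comm]
          exact hac p hp hap
        have hF := pow_mul_norm_fourier_le (hG p hp) (hGs p) (hN p hp) ζ
        calc ‖ζ‖ ^ k * (|a p| * ‖𝓕 (fun x => ((χ x * inner ℝ p.2 (f x) : ℝ) : ℂ)) ζ‖)
            ≤ (c⁻¹ * |inner ℝ p.1 ζ|) ^ k *
                (D * ‖𝓕 (fun x => ((χ x * inner ℝ p.2 (f x) : ℝ) : ℂ)) ζ‖) := by
              gcongr
              exact haD p hp
          _ = D * (c⁻¹ ^ k * (|inner ℝ p.1 ζ| ^ k *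
                ‖𝓕 (fun x => ((χ x * inner ℝ p.2 (f x) : ℝ) : ℂ)) ζ‖)) := by ring
          _ ≤ _ := by gcongr

theorem contDiffAt_and_norm_iteratedFDeriv_le {c D : ℝ} (hc : 0 < c) (hD : 0 ≤ D)
    (hcoef : ∀ ζ : EuclideanSpace ℝ (Fin n), ζ ≠ 0 → ∀ i : Fin m,
      ∃ a : EuclideanSpace ℝ (Fin n) × EuclideanSpace ℝ (Fin m) → ℝ,
        (∀ p ∈ T, |a p| ≤ D) ∧ (∀ p ∈ T, a p ≠ 0 → c * ‖ζ‖ ≤ |inner ℝ p.1 ζ|) ∧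
        ∑ p ∈ T, a p • p.2 = EuclideanSpace.single i 1)
    (hf : ∀ p ∈ T, DirSmooth p.1 (fun x => inner ℝ p.2 (f x)))
    {i : Fin m} (hfi : Continuous fun x => f x i)
    {χ : EuclideanSpace ℝ (Fin n) → ℝ} (hχ : ContDiff ℝ ∞ χ) {R ρ : ℝ}
    (hone : ∀ x ∈ ball 0 R, χ x = 1)
    (hsupp : tsupport χ ⊆ closedBall 0 ρ) {l : ℕ} {N N₀ : ℝ} (hN0 : 0 ≤ N)
    (hN : ∀ p ∈ T, ∀ x, |dirDeriv p.1 (l + n + 1) (fun x => χ x * inner ℝ p.2 (f x)) x| ≤ N)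
    (hN₀ : ∀ x, |χ x * f x i| ≤ N₀) {x : EuclideanSpace ℝ (Fin n)} (hx : x ∈ ball 0 R) :
    ContDiffAt ℝ l (fun x => f x i) x ∧ ‖iteratedFDeriv ℝ l (fun x => f x i) x‖ ≤
      (2 * Real.pi) ^ l * (2 ^ (n + 1) *
        (N₀ * volume.real (closedBall (0 : EuclideanSpace ℝ (Fin n)) ρ) +
          T.card * (D * (c⁻¹ ^ (l + n + 1) *
            (N * volume.real (closedBall (0 : EuclideanSpace ℝ (Fin n)) ρ))))) *
        ∫ ζ : EuclideanSpace ℝ (Fin n), (1 + ‖ζ‖) ^ (-(n + 1 : ℝ))) := by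
  let G : EuclideanSpace ℝ (Fin n) → ℝ := fun x => χ x * f x i
  have hG : Continuous G := hχ.continuous.mul hfi
  have hGs : tsupport G ⊆ closedBall 0 ρ := tsupport_mul_subset_left.trans hsupp
  have hGc : HasCompactSupport G :=
    (isCompact_closedBall _ _).of_isClosed_subset (isClosed_tsupport _) hGs
  obtain ⟨h1, h2⟩ := contDiff_of_fourier_decay (F := fun x => (G x : ℂ)) (l := l)
    (Complex.continuous_ofReal.comp hG)
    (hGc.comp_left (g := ((↑) : ℝ → ℂ)) Complex.ofReal_zero)
    (norm_fourier_le (ρ := ρ) (N := N₀)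
      (fun x hx => by
        rw [image_eq_zero_of_notMem_tsupport (f := G) (fun h => hx (hGs h)), Complex.ofReal_zero])
      (fun x => by simpa [G] using hN₀ x))
    (pow_mul_norm_fourier_coord_le hc hD hcoef hf hχ hsupp (by omega) hN0 hN i)
  have hGd : ContDiff ℝ l G := Complex.reCLM.contDiff.comp h1
  have hev : (fun x => f x i) =ᶠ[𝓝 x] G := by
    filter_upwards [isOpen_ball.mem_nhds hx] with y hy
    simp [G, hone y hy]
  refine ⟨hGd.contDiffAt.congr_of_eventuallyEq hev, ?_⟩
  rw [(hev.iteratedFDeriv ℝ l).eq_of_nhds]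
  refine le_trans (le_of_eq ?_) (h2 x)
  exact (Complex.ofRealLI.norm_iteratedFDeriv_comp_left hGd.contDiffAt le_rfl).symm

theorem IsDetermining.contDiff_coord
    (hT : IsDetermining (T : Set (EuclideanSpace ℝ (Fin n) × EuclideanSpace ℝ (Fin m))))
    (hf : ∀ p ∈ T, DirSmooth p.1 (fun x => inner ℝ p.2 (f x))) (i : Fin m) :
    ContDiff ℝ ∞ fun x => f x i := by
  obtain ⟨c, hc, D, hD, hcoef⟩ := hT.exists_coeff
  obtain ⟨C, -, hcut⟩ := exists_cutoff n
  have hfi := hT.continuous (fun p hp => (hf p hp).1) i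
  rw [contDiff_infty]
  intro l
  rw [contDiff_iff_contDiffAt]
  intro x
  obtain ⟨χ, hχ, hone, hsupp, -⟩ := hcut 1 le_rfl (‖x‖ + 1) (by positivity)
  have hχc : HasCompactSupport χ :=
    (isCompact_closedBall _ _).of_isClosed_subset (isClosed_tsupport _) hsupp
  have hex : ∀ p ∈ T, ∃ N : ℝ, ∀ x,
      |dirDeriv p.1 (l + n + 1) (fun x => χ x * inner ℝ p.2 (f x)) x| ≤ N := by
    intro p hp
    have hs := (dirSmooth_of_contDiff hχ p.1).mul (hf p hp)
    obtain ⟨N, hN⟩ := (hs.continuous_dirDeriv (l + n + 1)).bounded_above_of_compact_support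
      (HasCompactSupport.mono' (hχc.mul_right (f' := fun x => inner ℝ p.2 (f x)))
        ((subset_tsupport _).trans (tsupport_dirDeriv_subset _ _)))
    exact ⟨N, hN⟩
  choose! N hN using hex
  obtain ⟨N₀, hN₀⟩ := (hχ.continuous.mul hfi).bounded_above_of_compact_support hχc.mul_right
  refine (contDiffAt_and_norm_iteratedFDeriv_le hc hD hcoef hf hfi hχ hone hsupp
    (N := ∑ p ∈ T, |N p|) (Finset.sum_nonneg fun _ _ => abs_nonneg _) (fun p hp y => ?_)
    (fun y => hN₀ y) (by simp)).1
  exact (hN p hp y).trans ((le_abs_self _).trans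
    (Finset.single_le_sum (f := fun p => |N p|) (fun _ _ => abs_nonneg _) hp))

theorem IsDetermining.norm_iteratedFDeriv_le {M : ℕ → ℝ} (hM0 : M 0 = 1)
    (hMfac : ∀ k : ℕ, (k.factorial : ℝ) ≤ M k)
    (hMinc : ∀ j k : ℕ, 1 ≤ j → j < k → M j ^ (1 / (j : ℝ)) < M k ^ (1 / (k : ℝ)))
    (hMdiff : ∃ C : ℝ, 0 < C ∧ ∀ k : ℕ, M (k + 1) ≤ C ^ k * M k)
    (hT : IsDetermining (T : Set (EuclideanSpace ℝ (Fin n) × EuclideanSpace ℝ (Fin m)))) :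
    ∃ B : ℝ, 0 ≤ B ∧ ∀ f : EuclideanSpace ℝ (Fin n) → EuclideanSpace ℝ (Fin m),
      (∀ p ∈ T, DirSmooth p.1 (fun x => inner ℝ p.2 (f x))) → ∀ R h A : ℝ, 0 < R → 0 < h → 0 ≤ A →
      (∀ p ∈ T, ∀ j, ∀ x ∈ closedBall 0 (4 * R),
        |dirDeriv p.1 j (fun x => inner ℝ p.2 (f x)) x| ≤ A * (h ^ j * M j)) →
      ∀ i, ∃ A' : ℝ, 0 ≤ A' ∧ ∀ l, ∀ x ∈ ball 0 R, ‖iteratedFDeriv ℝ l (fun x => f x i) x‖ ≤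
        A' * ((2 * Real.pi) ^ l + (B * (1 / R + h)) ^ l * M l) := by
  have hpos : ∀ k, 0 ≤ M k := fun k => le_trans (by positivity) (hMfac k)
  obtain ⟨c, hc, D, hD, hcoef⟩ := hT.exists_coeff
  obtain ⟨C, hC, hcut⟩ := exists_cutoff n
  obtain ⟨P, hP, hPM⟩ := exists_weight_add_le hpos hMdiff (n + 1)
  set X : ℝ := ∑ p ∈ T, ‖p.1‖ with hX
  have hX0 : 0 ≤ X := Finset.sum_nonneg fun _ _ => norm_nonneg _
  -- Chosen so that e C‖ξ‖/R + h ≤ Y (1/R + h) for every ξ occurring in T.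
  set Y : ℝ := Real.exp 1 * C * X + 1 with hY
  have hY0 : 0 < Y := by positivity
  refine ⟨2 * Real.pi * P * c⁻¹ * Y, by positivity, fun f hf R h A hR hh hA hbd i => ?_⟩
  have hfi := hT.continuous (fun p hp => (hf p hp).1) i
  obtain ⟨N₀, hN₀⟩ :=
    (isCompact_closedBall (0 : EuclideanSpace ℝ (Fin n)) (4 * R)).exists_bound_of_continuousOn hfi.continuousOn
  set H : ℝ := Y * (1 / R + h) with hH
  have hH0 : 0 < H := by positivity
  set V := volume.real (closedBall (0 : EuclideanSpace ℝ (Fin n)) (4 * R)) with hV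
  have hV0 : 0 ≤ V := measureReal_nonneg
  set J := ∫ ζ : EuclideanSpace ℝ (Fin n), (1 + ‖ζ‖) ^ (-(n + 1 : ℝ)) with hJ
  have hJ0 : 0 ≤ J := integral_nonneg fun ζ => by positivity
  refine ⟨2 ^ (n + 1) * J * (|N₀| * V + T.card * (D * (c⁻¹ ^ (n + 1) * (A * H ^ (n + 1) * P * V)))),
    by positivity, fun l x hx => ?_⟩
  -- The cutoff varies with l, while the constant fixed above uses only its support and |χ| ≤ 1.
  obtain ⟨χ, hχ, hone, hsupp, hder⟩ := hcut (l + n + 1) (by omega) R hR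
  have hmain := (contDiffAt_and_norm_iteratedFDeriv_le hc hD hcoef hf hfi hχ hone hsupp (l := l)
    (N := A * (H ^ (l + n + 1) * M (l + n + 1))) (N₀ := |N₀|)
    (mul_nonneg hA (mul_nonneg (by positivity) (hpos _))) (fun p hp y => ?_) (fun y => ?_) hx).2
  · refine hmain.trans ?_
    have hM1 : M (l + n + 1) ≤ P ^ (l + 1) * M l := hPM l
    calc _ ≤ (2 * Real.pi) ^ l * (2 ^ (n + 1) * (|N₀| * V + T.card * (D * (c⁻¹ ^ (l + n + 1) *
            (A * (H ^ (l + n + 1) * (P ^ (l + 1) * M l)) * V)))) * J) := by gcongr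
      _ = 2 ^ (n + 1) * J * (|N₀| * V * (2 * Real.pi) ^ l +
            T.card * (D * (c⁻¹ ^ (n + 1) * (A * H ^ (n + 1) * P * V))) *
              ((2 * Real.pi * P * c⁻¹ * Y * (1 / R + h)) ^ l * M l)) := by
          rw [mul_assoc (2 * Real.pi * P * c⁻¹) Y, ← hH]
          ring_nf
      _ ≤ _ := by
          have e1 : 0 ≤ (2 * Real.pi) ^ l := by positivity
          have e2 : 0 ≤ (2 * Real.pi * P * c⁻¹ * Y * (1 / R + h)) ^ l * M l :=
            mul_nonneg (by positivity) (hpos l)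
          have e3 : 0 ≤ |N₀| * V := by positivity
          have e4 : 0 ≤ T.card * (D * (c⁻¹ ^ (n + 1) * (A * H ^ (n + 1) * P * V))) := by positivity
          rw [mul_assoc (2 ^ (n + 1) * J)]
          refine mul_le_mul_of_nonneg_left ?_ (by positivity)
          nlinarith [mul_nonneg e3 e2, mul_nonneg e4 e1]
  · by_cases hy : y ∈ closedBall 0 (4 * R)
    · have hle : ‖p.1‖ ≤ X := Finset.single_le_sum (f := fun p : EuclideanSpace ℝ (Fin n) ×
        EuclideanSpace ℝ (Fin m) => ‖p.1‖) (fun _ _ => norm_nonneg _) hp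
      refine (abs_dirDeriv_mul_le hM0 hMfac hMinc (dirSmooth_of_contDiff hχ p.1) (hf p hp)
        (k := l + n + 1) (by omega) (a := C * ‖p.1‖ / R) (by positivity) hh.le hA
        (fun j hj => ?_) (fun j _ => hbd p hp j y hy)).trans ?_
      · refine (hder j hj p.1 y).trans_eq ?_
        ring
      · have hHb : Real.exp 1 * (C * ‖p.1‖ / R) + h ≤ H := by
          have e1 : Real.exp 1 * (C * ‖p.1‖ / R) = Real.exp 1 * C * ‖p.1‖ * (1 / R) := by ring
          have e2 : Real.exp 1 * C * ‖p.1‖ ≤ Real.exp 1 * C * X := by gcongr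
          have e3 : 0 < 1 / R := by positivity
          have e4 : 0 ≤ Real.exp 1 * C * X := by positivity
          rw [hH, hY, e1]
          nlinarith [mul_le_mul_of_nonneg_right e2 e3.le, mul_nonneg e4 hh.le]
        have := hpos (l + n + 1)
        gcongr
    · rw [dirDeriv_eq_zero_of_notMem_tsupport
        (fun h => hy (hsupp (tsupport_mul_subset_left h))), abs_zero]
      exact mul_nonneg hA (mul_nonneg (by positivity) (hpos _))
  · by_cases hy : y ∈ closedBall 0 (4 * R)
    · have h1 : |χ y| ≤ 1 := by simpa using hder 0 (Nat.zero_le _) 0 y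
      rw [abs_mul]
      exact (mul_le_mul h1 ((hN₀ y hy).trans (le_abs_self _)) (abs_nonneg _) zero_le_one).trans_eq
        (one_mul _)
    · rw [image_eq_zero_of_notMem_tsupport (fun h => hy (hsupp h)), zero_mul, abs_zero]
      positivity

end Regularity

/-! ### Partial derivatives as values of the full derivative -/

section MultiIndex

variable {n : ℕ} {g : EuclideanSpace ℝ (Fin n) → ℝ}

theorem exists_partialDeriv_iterate_eq (hg : ContDiff ℝ ∞ g) (i : Fin n) (k : ℕ) {d : ℕ}
    {v : Fin d → EuclideanSpace ℝ (Fin n)} (hv : ∀ j, ‖v j‖ ≤ 1) :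
    ∃ w : Fin (d + k) → EuclideanSpace ℝ (Fin n), (∀ j, ‖w j‖ ≤ 1) ∧
      (partialDeriv i)^[k] (fun x => iteratedFDeriv ℝ d g x v) =
        fun x => iteratedFDeriv ℝ (d + k) g x w := by
  induction k with
  | zero => exact ⟨v, hv, rfl⟩
  | succ k ih =>
    obtain ⟨w, hw, h⟩ := ih
    refine ⟨Fin.cons (EuclideanSpace.single i 1) w, fun j => ?_, ?_⟩
    · refine Fin.cases ?_ (fun j => ?_) j
      · simp
      · simpa using hw j
    · rw [Function.iterate_succ_apply', h]
      ext x
      have hd : Differentiable ℝ (iteratedFDeriv ℝ (d + k) g) :=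
        hg.differentiable_iteratedFDeriv (by exact_mod_cast WithTop.coe_lt_top _)
      have hd' : DifferentiableAt ℝ (fun y => iteratedFDeriv ℝ (d + k) g y w) x :=
        (hd x).continuousMultilinear_apply_const w
      rw [partialDeriv, hd'.lineDeriv_eq_fderiv, fderiv_continuousMultilinear_apply_const_apply (hd x)]
      rfl

theorem abs_multiDeriv_le (hg : ContDiff ℝ ∞ g) (α : Fin n → ℕ) (x : EuclideanSpace ℝ (Fin n)) :
    |multiDeriv α g x| ≤ ‖iteratedFDeriv ℝ (∑ i, α i) g x‖ := by
  have key : ∀ L : List (Fin n), ∃ v : Fin (L.map α).sum → EuclideanSpace ℝ (Fin n),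
      (∀ j, ‖v j‖ ≤ 1) ∧ L.foldr (fun i φ => (partialDeriv i)^[α i] φ) g =
        fun x => iteratedFDeriv ℝ (L.map α).sum g x v := by
    intro L
    induction L with
    | nil => exact ⟨fun _ => 0, by simp, funext fun _ => (iteratedFDeriv_zero_apply _).symm⟩
    | cons i L ih =>
      obtain ⟨v, hv, h⟩ := ih
      rw [List.foldr_cons, h, List.map_cons, List.sum_cons, add_comm]
      exact exists_partialDeriv_iterate_eq hg i (α i) hv
  obtain ⟨v, hv, h⟩ := key (List.finRange n)
  rw [multiDeriv, h, Fin.sum_univ_def, ← Real.norm_eq_abs]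
  exact (ContinuousMultilinearMap.le_opNorm _ v).trans (mul_le_of_le_one_right (norm_nonneg _)
    (Finset.prod_le_one (fun _ _ => norm_nonneg _) fun j _ => hv j))

end MultiIndex

/-! ### Class membership and the counterexample -/

section Classes

variable {n m : ℕ} {M : ℕ → ℝ}

theorem DirSeminormFinite.mono (hpos : ∀ k, 0 < M k) {ξ : EuclideanSpace ℝ (Fin n)} {h h' : ℝ}
    (hh : 0 < h) (hhh' : h ≤ h') {K : Set (EuclideanSpace ℝ (Fin n))}
    {g : EuclideanSpace ℝ (Fin n) → ℝ} (hg : DirSeminormFinite M ξ h K g) :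
    DirSeminormFinite M ξ h' K g := by
  obtain ⟨A, hA⟩ := hg
  refine ⟨A, fun j x hx => le_trans ?_ (hA j x hx)⟩
  have := hpos j
  gcongr

theorem IsDetermining.seminormFinite (hM0 : M 0 = 1)
    (hMfac : ∀ k : ℕ, (k.factorial : ℝ) ≤ M k)
    (hMinc : ∀ j k : ℕ, 1 ≤ j → j < k → M j ^ (1 / (j : ℝ)) < M k ^ (1 / (k : ℝ)))
    (hMdiff : ∃ C : ℝ, 0 < C ∧ ∀ k : ℕ, M (k + 1) ≤ C ^ k * M k)
    {T : Finset (EuclideanSpace ℝ (Fin n) × EuclideanSpace ℝ (Fin m))}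
    (hT : IsDetermining (T : Set (EuclideanSpace ℝ (Fin n) × EuclideanSpace ℝ (Fin m)))) :
    ∃ B : ℝ, 0 ≤ B ∧ ∀ f : EuclideanSpace ℝ (Fin n) → EuclideanSpace ℝ (Fin m),
      (∀ p ∈ T, DirSmooth p.1 (fun x => inner ℝ p.2 (f x))) → ∀ R h : ℝ, 0 < R → 0 < h →
      (∀ p ∈ T, DirSeminormFinite M p.1 h (closedBall 0 (4 * R)) (fun x => inner ℝ p.2 (f x))) →
      ∀ h' : ℝ, 0 < h' → B * (1 / R + h) ≤ h' → ∀ K ⊆ ball 0 R, ∀ i,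
        SeminormFinite M h' K (fun x => f x i) := by
  have hpos : ∀ k, 0 < M k := fun k =>
    lt_of_lt_of_le (by exact_mod_cast k.factorial_pos) (hMfac k)
  obtain ⟨B, hB, hmain⟩ := hT.norm_iteratedFDeriv_le hM0 hMfac hMinc hMdiff
  refine ⟨B, hB, fun f hf R h hR hh hfin h' hh' hle K hK i => ?_⟩
  choose! A hA using hfin
  obtain ⟨A', hA', hbd⟩ := hmain f hf R h (∑ p ∈ T, |A p|) hR hh
    (Finset.sum_nonneg fun _ _ => abs_nonneg _) (fun p hp j x hx => by
      have hj : 0 < h ^ j * M j := mul_pos (by positivity) (hpos j)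
      refine ((div_le_iff₀ hj).1 (hA p hp j x hx)).trans (mul_le_mul_of_nonneg_right ?_ hj.le)
      exact (le_abs_self _).trans
        (Finset.single_le_sum (f := fun p => |A p|) (fun _ _ => abs_nonneg _) hp)) i
  -- The exponential bounds (2π/h')ˡ / l!, so M_l ≥ l! absorbs the term (2π)ˡ for any h' > 0.
  refine ⟨A' * (Real.exp (2 * Real.pi / h') + 1), fun α x hx => ?_⟩
  set l := ∑ i, α i
  have hl : 0 < h' ^ l * M l := mul_pos (by positivity) (hpos l)
  rw [div_le_iff₀ hl]
  refine (abs_multiDeriv_le (hT.contDiff_coord hf i) α x).trans ((hbd l x (hK hx)).trans ?_)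
  rw [mul_assoc]
  refine mul_le_mul_of_nonneg_left ?_ hA'
  rw [add_mul, one_mul]
  refine add_le_add ?_ ?_
  · have h1 := Real.pow_div_factorial_le_exp (x := 2 * Real.pi / h') (by positivity) l
    rw [div_le_iff₀ (by positivity), div_pow, div_le_iff₀ (by positivity)] at h1
    calc (2 * Real.pi) ^ l ≤ Real.exp (2 * Real.pi / h') * l.factorial * h' ^ l := h1
      _ ≤ Real.exp (2 * Real.pi / h') * M l * h' ^ l := by
        gcongr
        exact hMfac l
      _ = _ := by ring
  · have := hpos l
    gcongr

theorem dirDeriv_of_invariant {ξ : EuclideanSpace ℝ (Fin n)} {g : EuclideanSpace ℝ (Fin n) → ℝ}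
    (h : ∀ x, ∀ t : ℝ, g (x + t • ξ) = g x) {j : ℕ} (hj : j ≠ 0) : dirDeriv ξ j g = 0 := by
  ext x
  simp only [dirDeriv, h]
  simp [iteratedDeriv_const, hj]

theorem dirSmooth_of_invariant {ξ : EuclideanSpace ℝ (Fin n)} {g : EuclideanSpace ℝ (Fin n) → ℝ}
    (hg : Continuous g) (h : ∀ x, ∀ t : ℝ, g (x + t • ξ) = g x) : DirSmooth ξ g := by
  refine ⟨hg, fun x => ?_, fun j hj => ?_⟩
  · simp only [h]
    exact contDiff_const
  · rw [dirDeriv_of_invariant h (by omega)]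
    exact continuous_const

theorem dirSeminormFinite_of_invariant (hM0 : M 0 = 1) {ξ : EuclideanSpace ℝ (Fin n)}
    {g : EuclideanSpace ℝ (Fin n) → ℝ} (hg : Continuous g) (h : ∀ x, ∀ t : ℝ, g (x + t • ξ) = g x)
    {K : Set (EuclideanSpace ℝ (Fin n))} (hK : IsCompact K) (b : ℝ) :
    DirSeminormFinite M ξ b K g := by
  obtain ⟨A, hA⟩ := hK.exists_bound_of_continuousOn hg.continuousOn
  refine ⟨|A|, fun j x hx => ?_⟩
  rcases eq_or_ne j 0 with rfl | hj
  · simpa [hM0] using (hA x hx).trans (le_abs_self A)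
  · simp [dirDeriv_of_invariant h hj]

theorem exists_not_contDiff_of_not_isDetermining
    {Λ : Set (EuclideanSpace ℝ (Fin n) × EuclideanSpace ℝ (Fin m))} (hΛ : ¬ IsDetermining Λ) :
    ∃ f : EuclideanSpace ℝ (Fin n) → EuclideanSpace ℝ (Fin m), LocallyBounded f ∧
      (∀ p ∈ Λ, Continuous (fun x => inner ℝ p.2 (f x)) ∧
        ∀ x, ∀ t : ℝ, inner ℝ p.2 (f (x + t • p.1)) = inner ℝ p.2 (f x)) ∧
      ∃ i, ¬ ContDiff ℝ ∞ fun x => f x i := by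
  obtain ⟨u, v, hu, hv, h⟩ := exists_ne_zero_of_not_isDetermining hΛ
  -- ⟨η, f⟩ = |⟨u, x⟩|⟨v, η⟩ either vanishes or is constant along ξ.
  let f : EuclideanSpace ℝ (Fin n) → EuclideanSpace ℝ (Fin m) := fun x => |inner ℝ u x| • v
  have hf : Continuous f := by fun_prop
  refine ⟨f, fun x => ⟨closedBall x 1, closedBall_mem_nhds x one_pos,
    ((isCompact_closedBall x 1).image hf).isBounded⟩, fun p hp => ⟨by fun_prop, fun x t => ?_⟩, ?_⟩
  · simp only [f, real_inner_smul_right]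
    rcases h p hp with h | h
    · rw [inner_add_right, real_inner_smul_right, h, mul_zero, add_zero]
    · rw [real_inner_comm p.2 v] at h
      rw [h, mul_zero, mul_zero]
  · obtain ⟨i, hi⟩ : ∃ i, v i ≠ 0 := by
      by_contra! h0
      exact hv (by ext i; exact h0 i)
    refine ⟨i, fun hc => not_differentiableAt_abs_zero ?_⟩
    have hu' : inner ℝ u u ≠ 0 := inner_self_ne_zero.2 hu
    have hd : Differentiable ℝ fun t : ℝ => f ((t / inner ℝ u u) • u) i / v i :=
      ((hc.differentiable (by simp)).comp (by fun_prop : Differentiable ℝ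
        fun t : ℝ => (t / inner ℝ u u) • u)).div_const _
    have he : (fun t : ℝ => f ((t / inner ℝ u u) • u) i / v i) = abs := by
      ext t
      simp only [f, real_inner_smul_right, div_mul_cancel₀ _ hu', PiLp.smul_apply, smul_eq_mul]
      exact mul_div_cancel_right₀ _ hi
    exact he ▸ hd 0

end Classes

end Boman

/-! ### The equivalence -/

theorem theorem2 {n m : ℕ}
    (Λ : Set (EuclideanSpace ℝ (Fin n) × EuclideanSpace ℝ (Fin m)))
    (M : ℕ → ℝ)
    (hM0 : M 0 = 1)
    (hMfac : ∀ k : ℕ, (k.factorial : ℝ) ≤ M k)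
    (hMinc : ∀ j k : ℕ, 1 ≤ j → j < k → M j ^ (1 / (j : ℝ)) < M k ^ (1 / (k : ℝ)))
    (hMdiff : ∃ C : ℝ, 0 < C ∧ ∀ k : ℕ, M (k + 1) ≤ C ^ k * M k) :
    List.TFAE [
      Boman.IsDetermining Λ,
      ∀ f : EuclideanSpace ℝ (Fin n) → EuclideanSpace ℝ (Fin m), Boman.LocallyBounded f →
        (∀ p ∈ Λ, Boman.DirCarleman M p.1 (fun x => inner ℝ p.2 (f x))) →
        ∀ i, Boman.Carleman M (fun x => f x i),
      ∀ f : EuclideanSpace ℝ (Fin n) → EuclideanSpace ℝ (Fin m), Boman.LocallyBounded f →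
        (∀ p ∈ Λ, Boman.DirBeurling M p.1 (fun x => inner ℝ p.2 (f x))) →
        ∀ i, Boman.Beurling M (fun x => f x i),
      ∀ f : EuclideanSpace ℝ (Fin n) → EuclideanSpace ℝ (Fin m), Boman.LocallyBounded f →
        (∀ p ∈ Λ, Boman.DirSmooth p.1 (fun x => inner ℝ p.2 (f x))) →
        ContDiff ℝ ∞ f] := by
  have hpos : ∀ k, 0 < M k := fun k =>
    lt_of_lt_of_le (by exact_mod_cast k.factorial_pos) (hMfac k)
  tfae_have 1 → 4 := by
    intro hΛ f _ hf
    obtain ⟨T, hTΛ, hT⟩ := hΛ.exists_finset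
    exact contDiff_euclidean.2 (hT.contDiff_coord fun p hp => hf p (hTΛ hp))
  tfae_have 1 → 2 := by
    intro hΛ f _ hf i
    obtain ⟨T, hTΛ, hT⟩ := hΛ.exists_finset
    have hs : ∀ p ∈ T, Boman.DirSmooth p.1 (fun x => inner ℝ p.2 (f x)) :=
      fun p hp => (hf p (hTΛ hp)).1
    refine ⟨hT.contDiff_coord hs i, fun K hK => ?_⟩
    obtain ⟨B, hB, hmain⟩ := hT.seminormFinite hM0 hMfac hMinc hMdiff
    obtain ⟨R, hR, hKR⟩ := hK.isBounded.subset_ball_lt 0 0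
    have hex : ∀ p ∈ T, ∃ h : ℝ, 0 < h ∧ Boman.DirSeminormFinite M p.1 h
        (Metric.closedBall 0 (4 * R)) (fun x => inner ℝ p.2 (f x)) :=
      fun p hp => (hf p (hTΛ hp)).2 _ (isCompact_closedBall _ _)
    choose! h hh hfin using hex
    have hsum : 0 ≤ ∑ p ∈ T, h p := Finset.sum_nonneg fun p hp => (hh p hp).le
    -- The sum dominates every `h p`; the added ones keep both parameters positive when T is empty
    -- or B = 0.
    refine ⟨B * (1 / R + (∑ p ∈ T, h p + 1)) + 1, by positivity,
      hmain f hs R (∑ p ∈ T, h p + 1) hR (by positivity) (fun p hp => ?_) _ (by positivity)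
        (by linarith) K hKR i⟩
    refine (hfin p hp).mono hpos (hh p hp) ?_
    linarith [Finset.single_le_sum (fun p hp => (hh p hp).le) hp]
  tfae_have 1 → 3 := by
    intro hΛ f _ hf i
    obtain ⟨T, hTΛ, hT⟩ := hΛ.exists_finset
    have hs : ∀ p ∈ T, Boman.DirSmooth p.1 (fun x => inner ℝ p.2 (f x)) :=
      fun p hp => (hf p (hTΛ hp)).1
    refine ⟨hT.contDiff_coord hs i, fun K hK h' hh' => ?_⟩
    obtain ⟨B, hB, hmain⟩ := hT.seminormFinite hM0 hMfac hMinc hMdiff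
    -- With R > 1/h one gets B(1/R + h) ≤ 2Bh ≤ h'; the Beurling hypothesis allows this h on the
    -- larger ball.
    set h := h' / (2 * (B + 1)) with hh
    have hh0 : 0 < h := by positivity
    obtain ⟨R, hR, hKR⟩ := hK.isBounded.subset_ball_lt (1 / h) 0
    have hR0 : 0 < R := lt_trans (by positivity) hR
    refine hmain f hs R h hR0 hh0
      (fun p hp => (hf p (hTΛ hp)).2 _ (isCompact_closedBall _ _) h hh0) h' hh' ?_ K hKR i
    have h1 : 1 / R ≤ h := by
      rw [div_le_iff₀ hR0]
      rw [div_lt_iff₀ hh0] at hR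
      linarith
    have h2 : h' = 2 * (B + 1) * h := by
      rw [hh]; field_simp
    nlinarith
  tfae_have 2 → 1 := by
    intro H
    by_contra hΛ
    obtain ⟨f, hb, hf, i, hi⟩ := Boman.exists_not_contDiff_of_not_isDetermining hΛ
    exact hi (H f hb (fun p hp => ⟨Boman.dirSmooth_of_invariant (hf p hp).1 (hf p hp).2,
      fun K hK => ⟨1, one_pos,
        Boman.dirSeminormFinite_of_invariant hM0 (hf p hp).1 (hf p hp).2 hK 1⟩⟩) i).1
  tfae_have 3 → 1 := by
    intro H
    by_contra hΛ
    obtain ⟨f, hb, hf, i, hi⟩ := Boman.exists_not_contDiff_of_not_isDetermining hΛ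
    exact hi (H f hb (fun p hp => ⟨Boman.dirSmooth_of_invariant (hf p hp).1 (hf p hp).2,
      fun K hK h _ => Boman.dirSeminormFinite_of_invariant hM0 (hf p hp).1 (hf p hp).2 hK h⟩) i).1
  tfae_have 4 → 1 := by
    intro H
    by_contra hΛ
    obtain ⟨f, hb, hf, i, hi⟩ := Boman.exists_not_contDiff_of_not_isDetermining hΛ
    exact hi (contDiff_euclidean.1 (H f hb fun p hp =>
      Boman.dirSmooth_of_invariant (hf p hp).1 (hf p hp).2) i)
  tfae_finish
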